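/- **Consistency of the reweighted Nadaraya–Watson (RNW) estimator.** Let $w\ge 1$ and let $V_i=(\tilde X_i,\tilde Y_i)$, $i\ge 1$, be a strictly stationary process with values in $\mathbb R^w\times\mathbb R$ that is strongly mixing with $\alpha(\tau)=O(\tau^{-(2+\delta)})$ for some $\delta>0$, where $$\alpha(\tau)=\sup_{k\ge1}\ \sup_{A\in\sigma(V_1,\dots,V_k),\ B\in\sigma(V_{k+\tau},V_{k+\tau+1},\dots)}|\mathbb P(A\cap B)-\mathbb P(A)\mathbb P(B)| .$$ Let $F(b\mid u)=\mathbb P(\tilde Y_1\le b\mid \tilde X_1=u)$ (a version obtained from a regular conditional distribution), let $g$ be a density of $\tilde X_1$ and, for $i\ge2$, let $g_{1,i}$ be a joint density of $(\tilde X_1,\tilde X_i)$. Fix $\tilde x\in\mathbb R^w$ and $\tilde y\in\mathbb R$ and assume: * $0<F(\tilde y\mid\tilde x)<1$, and $u\mapsto F(\tilde y\mid u)$ is twice continuously differentiable in a neighbourhood of $\tilde x$; * $g(\tilde x)>0$ and $g$ is continuous at $\tilde x$; there is $M>0$ with $|g_{1,i}(u,v)-g(u)g(v)|\le M$ for all $u,v$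 and all $i\ge2$; * $K:\mathbb R^w\to\mathbb R$ is a nonnegative, bounded, continuous, compactly supported probability density with $\int uK(u)\,du=0$, $\int uu^\top K(u)\,du=\mu_2 I$, $\int K^2(u)\,du=\nu_0$ and $\int uu^\top K^2(u)\,du=\nu_2I$ for some $\mu_2,\nu_0,\nu_2\in(0,\infty)$; * the bandwidths $h=h_n>0$ satisfy $h\to0$ and $nh^{w(1+2/\delta)}\to\infty$ as $n\to\infty$. Put $K_h(u)=h^{-w}K(u/h)$. Let the adjustment weights $p_1,\dots,p_n$ (depending on $\tilde x$ and the sample) maximize $\sum_{i=1}^n\log p_i$ subject to $p_i\ge0$, $\sum_{i=1}^np_i=1$ and $\sum_{i=1}^n p_i(\tilde X_i-\tilde x)K_h(\tilde X_i-\tilde x)=0\in\mathbb R^w$ (they may be chosen arbitrarily where this problem has no solution), and let $$\widehat F(\tilde y\mid\tilde x)=\frac{\sum_{i=1}^np_iK_h(\tilde X_i-\tilde x)\,\mathbb 1(\tilde Y_i\le\tilde y)}{\sum_{i=1}^np_iK_h(\tilde X_i-\tilde x)} .$$ Then, as $n\to\infty$, $$\widehat F(\tilde y\mid\tilde x)-F(\tilde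 y\mid\tilde x)=\tfrac12h^2\,\mathrm{tr}\big(D^2_{\tilde x}F(\tilde y\mid\tilde x)\big)\,\mu_2+o_p(h^2)+O_p\big((nh^w)^{-1/2}\big),$$ where $D^2_{\tilde x}F(\tilde y\mid\tilde x)$ is the Hessian of $u\mapsto F(\tilde y\mid u)$ at $u=\tilde x$. -/

import Mathlib

open MeasureTheory ProbabilityTheory Filter Topology

namespace RNW

/-- Predictors live in `ℝ^w` with the Euclidean norm and Lebesgue measure. -/
abbrev E (w : ℕ) : Type := EuclideanSpace ℝ (Fin w)

noncomputable section

/-! ### Dependence of the process -/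

section Dependence

variable {Ω S : Type*} [MeasurableSpace Ω] [MeasurableSpace S]

/-- The σ-algebra generated by `V_0, …, V_k`. -/
abbrev past (V : ℕ → Ω → S) (k : ℕ) : MeasurableSpace Ω :=
  ⨆ (i : ℕ) (_ : i ≤ k), MeasurableSpace.comap (V i) inferInstance

/-- The σ-algebra generated by `V_k, V_{k+1}, …`. -/
abbrev future (V : ℕ → Ω → S) (k : ℕ) : MeasurableSpace Ω :=
  ⨆ (i : ℕ) (_ : k ≤ i), MeasurableSpace.comap (V i) inferInstance

/-- The α-mixing coefficient of a one-sided process: the supremum of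
`|P(A ∩ B) - P(A) P(B)|` over all times `k`, all events `A` of the past up to `k` and all
events `B` of the future from `k + τ` on. For a stationary process it is the coefficient of the
two-sided stationary extension, where the single time `k = 0` is enough. -/
def alphaMixing (μ : Measure Ω) (V : ℕ → Ω → S) (τ : ℕ) : ℝ :=
  sSup {r : ℝ | ∃ (k : ℕ) (A B : Set Ω), MeasurableSet[past V k] A ∧
    MeasurableSet[future V (k + τ)] B ∧ r = |μ.real (A ∩ B) - μ.real A * μ.real B|}

/-- Strict stationarity: every time shift of the process has the same law as the process. -/
def IsStationary (μ : Measure Ω) (V : ℕ → Ω → S) : Prop :=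
  ∀ k : ℕ, μ.map (fun ω (i : ℕ) => V (i + k) ω) = μ.map (fun ω (i : ℕ) => V i ω)

/-- A strictly stationary, strongly mixing process with `α(τ) = O(τ^{-(2+δ)})`. -/
structure MixingAssumption (μ : Measure Ω) (V : ℕ → Ω → S) (δ : ℝ) : Prop where
  stationary : IsStationary μ V
  strongly_mixing : Tendsto (alphaMixing μ V) atTop (𝓝 0)
  rate : alphaMixing μ V =O[atTop] fun τ : ℕ => (τ : ℝ) ^ (-(2 + δ))

end Dependence

/-! ### Conditional distribution function, densities and their smoothness -/

/-- `f` is (a version of) the Lebesgue density of the random element `Z`. -/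
def HasDensity {Ω S : Type*} [MeasurableSpace Ω] [MeasureSpace S]
    (μ : Measure Ω) (Z : Ω → S) (f : S → ℝ) : Prop :=
  Measurable f ∧ (∀ z, 0 ≤ f z) ∧ μ.map Z = volume.withDensity (fun z => ENNReal.ofReal (f z))

/-- The conditional distribution function `F(b | x)` read off a conditional distribution `κ`. -/
def condCDF {w : ℕ} (κ : Kernel (E w) ℝ) (b : ℝ) (x : E w) : ℝ := (κ x).real (Set.Iic b)

/-- The Hessian matrix `(∂_j ∂_k f(x))_{j,k}`. -/
def hessian {w : ℕ} (f : E w → ℝ) (x : E w) : Matrix (Fin w) (Fin w) ℝ :=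
  Matrix.of fun j k => fderiv ℝ (fun z => fderiv ℝ f z (EuclideanSpace.single k 1)) x
    (EuclideanSpace.single j 1)

/-- Smoothness at the fixed points `x`, `y`: here `κ` gives the conditional distribution
function, `g` is the marginal density of the predictors and `G i` is the joint density of
the predictors at times `0` and `i`, for `i ≥ 1`. -/
structure SmoothnessAssumption {w : ℕ} (κ : Kernel (E w) ℝ) (g : E w → ℝ)
    (G : ℕ → E w × E w → ℝ) (x : E w) (y : ℝ) : Prop where
  cdf_pos : 0 < condCDF κ y x
  cdf_lt_one : condCDF κ y x < 1
  cdf_smooth : ContDiffAt ℝ 2 (fun z => condCDF κ y z) x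
  density_pos : 0 < g x
  density_cont : ContinuousAt g x
  joint_bound : ∃ M : ℝ, 0 < M ∧ ∀ i : ℕ, 1 ≤ i → ∀ u v : E w, |G i (u, v) - g u * g v| ≤ M

/-! ### Kernel function and bandwidth -/

/-- A nonnegative, bounded, continuous, compactly supported probability density with the
moment conditions `∫ u K = 0`, `∫ u uᵀ K = μ₂ I`, `∫ K² = ν₀`, `∫ u uᵀ K² = ν₂ I`. -/
structure KernelAssumption {w : ℕ} (K : E w → ℝ) (μ₂ ν₀ ν₂ : ℝ) : Prop where
  nonneg : ∀ u, 0 ≤ K u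
  bounded : ∃ C : ℝ, ∀ u, K u ≤ C
  continuous : Continuous K
  compact_support : HasCompactSupport K
  integral_one : ∫ u, K u = 1
  first_moment : ∫ u, K u • u = 0
  second_moment_pos : 0 < μ₂
  second_moment : ∀ j k : Fin w,
    ∫ u : E w, u j * u k * K u = (μ₂ • (1 : Matrix (Fin w) (Fin w) ℝ)) j k
  sq_pos : 0 < ν₀
  sq_integral : ∫ u, K u ^ 2 = ν₀
  sq_second_moment_pos : 0 < ν₂
  sq_second_moment : ∀ j k : Fin w,
    ∫ u : E w, u j * u k * K u ^ 2 = (ν₂ • (1 : Matrix (Fin w) (Fin w) ℝ)) j k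

/-- The rescaled kernel `K_h(u) = h^{-w} K(u / h)`. -/
def scaledKernel {w : ℕ} (K : E w → ℝ) (h : ℝ) (u : E w) : ℝ := (h ^ w)⁻¹ * K (h⁻¹ • u)

/-- Positive bandwidths with `h → 0` and `n h^{w (1 + 2/δ)} → ∞`. -/
structure BandwidthAssumption (w : ℕ) (δ : ℝ) (h : ℕ → ℝ) : Prop where
  pos : ∀ n, 0 < h n
  tendsto_zero : Tendsto h atTop (𝓝 0)
  tendsto_top : Tendsto (fun n : ℕ => (n : ℝ) * h n ^ ((w : ℝ) * (1 + 2 / δ))) atTop atTop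

/-! ### The reweighted Nadaraya-Watson estimator -/

/-- The constraints on the adjustment weights at the point `x`, given the predictors
`xs 1, …, xs n`. -/
structure IsFeasible {w n : ℕ} (K : E w → ℝ) (h : ℝ) (x : E w) (xs : Fin n → E w)
    (p : Fin n → ℝ) : Prop where
  nonneg : ∀ i, 0 ≤ p i
  sum_one : ∑ i, p i = 1
  balance : ∑ i, (p i * scaledKernel K h (xs i - x)) • (xs i - x) = 0

/-- The empirical log-likelihood `∑ log p_i`, with value `-∞` if some `p_i` is zero. -/
def logLikelihood {n : ℕ} (p : Fin n → ℝ) : EReal := ∑ i, ENNReal.log (ENNReal.ofReal (p i))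

/-- `p` is a vector of adjustment weights: it maximizes the empirical log-likelihood subject to
the constraints. -/
def IsAdjustmentWeights {w n : ℕ} (K : E w → ℝ) (h : ℝ) (x : E w) (xs : Fin n → E w)
    (p : Fin n → ℝ) : Prop :=
  IsFeasible K h x xs p ∧
    ∀ q : Fin n → ℝ, IsFeasible K h x xs q → logLikelihood q ≤ logLikelihood p

/-- The final weights `p_i K_h(X_i - x) / ∑_j p_j K_h(X_j - x)`. -/
def finalWeight {w n : ℕ} (K : E w → ℝ) (h : ℝ) (x : E w) (xs : Fin n → E w)
    (p : Fin n → ℝ) (i : Fin n) : ℝ :=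
  p i * scaledKernel K h (xs i - x) / ∑ j, p j * scaledKernel K h (xs j - x)

/-- The reweighted Nadaraya-Watson estimate of `F(y | x)` built from adjustment weights `p`. -/
def estimator {w n : ℕ} (K : E w → ℝ) (h : ℝ) (x : E w) (xs : Fin n → E w) (ys : Fin n → ℝ)
    (p : Fin n → ℝ) (y : ℝ) : ℝ :=
  ∑ i, finalWeight K h x xs p i * Set.indicator (Set.Iic y) (fun _ => (1 : ℝ)) (ys i)

/-! ### Stochastic order symbols -/

/-- `R_n = o_p(a_n)` for a positive deterministic sequence `a`. -/
def IsLittleOInProb {Ω : Type*} [MeasurableSpace Ω] (μ : Measure Ω) (R : ℕ → Ω → ℝ)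
    (a : ℕ → ℝ) : Prop :=
  ∀ ε : ℝ, 0 < ε → Tendsto (fun n => μ {ω | ε * a n < |R n ω|}) atTop (𝓝 0)

/-- `R_n = O_p(a_n)` for a positive deterministic sequence `a`. -/
def IsBigOInProb {Ω : Type*} [MeasurableSpace Ω] (μ : Measure Ω) (R : ℕ → Ω → ℝ)
    (a : ℕ → ℝ) : Prop :=
  ∀ ε : ℝ, 0 < ε → ∃ M : ℝ, 0 < M ∧
    ∀ᶠ n in atTop, μ {ω | M * a n < |R n ω|} ≤ ENNReal.ofReal ε

end

end RNW

namespace RNW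

open scoped RealInnerProductSpace

/-! Write `u_i = (X_i - x)/h` and `z_i = K(u_i) u_i`. By Lagrange duality the weights are `p_i =
1/(n (1 + ⟨l, z_i⟩))`, where the tilt `l` solves the first order condition `∑ z_i / (1 + ⟨l, z_i⟩) =
0` (`adjustmentWeights_eq`). The tilt is a critical point of the concave function `∑ log (1 + ⟨l,
z_i⟩)`. Its linear part is `o_p(n h^w)` because `∫ u K = 0`, and its quadratic part is of exact
order `n h^w` because `∫ u uᵀ K² = ν₂ I`. So with probability tending to one there is a critical
point in any prescribed ball around zero (`exists_tilt`).

The estimation error splits into a bias part, with `F(X_i) - F(x)` in place of the indicator, and a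
noise part, with `1(Y_i ≤ y) - F(X_i)`. In the bias part the first order condition annihilates the
linear Taylor term exactly. The quadratic term is a kernel average with limit `tr(D²F) μ₂ / 2`, and
a tilt that is merely small perturbs it by a small multiple of `h²` (`abs_bias_le`).

The noise part is more delicate. As `g` is only continuous at `x`, the tilt tends to zero without a
rate, and it depends on the whole sample. It is therefore compared not with zero but with a
deterministic tilt solving the first order condition in expectation. The first order condition is
strongly monotone in the tilt, so the distance of the two tilts is controlled by the sample
condition evaluated at the population tilt (`norm_sub_tilt_le`). What remains (`abs_noise_le`) is `w
+ 1` sums of bounded functions supported near `x` with mean exactly zero.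

Such sums have variance `O(n h^w)` (`variance_sum_le`): a covariance at lag `τ ≥ 1` is `O(h^{2w})`
by the density bounds and `O(τ^{-2})` by mixing, and cutting the lags at `h^{-w}` makes their sum
`O(h^w)`. Chebyshev's inequality then gives the rate `(n h^w)^{-1/2}`, and the law of large numbers
for kernel averages used above. -/

/-- The cubic remainder of the series is at most `t²/4` on this range, which leaves half of the
quadratic term `t²/2`. This strict concavity keeps the maximizer in `exists_tilt` away from the
boundary. -/
theorem log_one_add_le_sub_sq {t : ℝ} (ht : |t| ≤ 1 / 8) :
    Real.log (1 + t) ≤ t - t ^ 2 / 4 := by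
  have h := Real.abs_log_sub_add_sum_range_le (x := -t) (by rw [abs_neg]; linarith) 2
  simp only [Finset.sum_range_succ, Finset.sum_range_zero, abs_neg] at h
  norm_num at h
  have h1 := (abs_le.mp h).2
  have h2 : |t| ^ 3 / (1 - |t|) ≤ t ^ 2 / 4 := by
    rw [div_le_iff₀ (by linarith), ← sq_abs t]
    nlinarith [sq_nonneg (|t|), abs_nonneg t]
  linarith

theorem abs_log_one_add_le {t : ℝ} (ht : |t| ≤ 1 / 8) : |Real.log (1 + t)| ≤ 1 := by
  have h := abs_le.mp ht
  have h1 : Real.log (1 + t) ≤ 1 := by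
    have := Real.log_le_sub_one_of_pos (x := 1 + t) (by linarith)
    linarith
  have h2 : -1 ≤ Real.log (1 + t) := by
    have := Real.one_sub_inv_le_log_of_pos (x := 1 + t) (by linarith)
    have h3 : (1 + t)⁻¹ ≤ 2 := by
      rw [inv_le_comm₀ (by linarith) (by norm_num)]; linarith
    linarith
  exact abs_le.mpr ⟨h2, h1⟩

/-! ### The first order condition for the tilt: existence and stability. -/

section Tilt

variable {A : Type*} [MeasurableSpace A] {w : ℕ}

theorem abs_inner_le_of_mul_le {l z : E w} {C r : ℝ} (hz : ‖z‖ ≤ C) (hl : ‖l‖ ≤ r)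
    (hrC : r * C ≤ 1 / 8) : |⟪l, z⟫| ≤ 1 / 8 := by
  have h1 := abs_real_inner_le_norm l z
  have : ‖l‖ * ‖z‖ ≤ r * C := by gcongr; exact (norm_nonneg l).trans hl
  linarith

theorem measurable_inner_left {W : A → E w} (hW : Measurable W) (l : E w) :
    Measurable fun a => ⟪l, W a⟫ :=
  (measurable_const.inner hW)

/-- The first order condition of the empirical likelihood problem is solvable in a ball as soon as
the mean of `W` is small in comparison with its second moments. -/
theorem exists_tilt (ν : Measure A) [IsFiniteMeasure ν] {W : A → E w} (hW : Measurable W)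
    {C r v s : ℝ} (hC : ∀ a, ‖W a‖ ≤ C) (hr : 0 < r) (hrC : r * C ≤ 1 / 8)
    (hmean : ∀ l : E w, ∫ a, ⟪l, W a⟫ ∂ν ≤ s * ‖l‖) (hs : s < v * r / 4)
    (hquad : ∀ l : E w, v * ‖l‖ ^ 2 ≤ ∫ a, ⟪l, W a⟫ ^ 2 ∂ν) :
    ∃ l : E w, ‖l‖ < r ∧ ∀ e : E w, ∫ a, ⟪e, W a⟫ / (1 + ⟪l, W a⟫) ∂ν = 0 := by
  -- The dual objective of the empirical likelihood problem; its gradient is the left side of the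
  -- first order condition.
  set Φ : E w → ℝ := fun l => ∫ a, Real.log (1 + ⟪l, W a⟫) ∂ν with hΦ
  have hmeas : ∀ l : E w, Measurable fun a => Real.log (1 + ⟪l, W a⟫) := fun l =>
    Real.measurable_log.comp (measurable_const.add (measurable_inner_left hW l))
  have hcont : ContinuousOn Φ (Metric.closedBall 0 r) := by
    refine continuousOn_of_dominated (bound := fun _ => 1)
      (fun l _ => (hmeas l).aestronglyMeasurable) (fun l hl => ?_) (integrable_const _) ?_
    · refine Eventually.of_forall fun a => ?_
      exact abs_log_one_add_le (abs_inner_le_of_mul_le (hC a) (by simpa using hl) hrC)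
    · refine Eventually.of_forall fun a => ContinuousOn.log (by fun_prop) fun l hl => ?_
      have := abs_le.mp (abs_inner_le_of_mul_le (hC a) (show ‖l‖ ≤ r by simpa using hl) hrC)
      linarith
  obtain ⟨l, hl, hmax⟩ := (isCompact_closedBall (0 : E w) r).exists_isMaxOn
    ⟨0, by simpa using hr.le⟩ hcont
  have hl' : ‖l‖ ≤ r := by simpa using hl
  have hint : ∀ l : E w, Integrable (fun a => ⟪l, W a⟫) ν := fun l =>
    Integrable.of_bound (measurable_inner_left hW l).aestronglyMeasurable (‖l‖ * C)
      (Eventually.of_forall fun a => (abs_real_inner_le_norm _ _).trans (by gcongr; exact hC a))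
  have hint2 : ∀ l : E w, Integrable (fun a => ⟪l, W a⟫ ^ 2) ν := fun l =>
    Integrable.of_bound ((measurable_inner_left hW l).pow_const 2).aestronglyMeasurable
      ((‖l‖ * C) ^ 2)
      (Eventually.of_forall fun a => by
        rw [norm_pow]
        exact pow_le_pow_left₀ (norm_nonneg _)
          ((abs_real_inner_le_norm _ _).trans (by gcongr; exact hC a)) 2)
  -- On the sphere `‖l‖ = r` the objective is at most `s r - v r² / 4 < 0 = Φ 0`, so the maximum
  -- over the closed ball is attained inside.
  have hlt : ‖l‖ < r := by
    refine lt_of_le_of_ne hl' fun heq => ?_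
    have h0 : (0 : ℝ) ≤ Φ l := by
      have := hmax (show (0 : E w) ∈ Metric.closedBall 0 r by simpa using hr.le)
      simpa [hΦ] using this
    have h1 : Φ l ≤ ∫ a, (⟪l, W a⟫ - ⟪l, W a⟫ ^ 2 / 4) ∂ν := by
      refine integral_mono (Integrable.of_bound (hmeas l).aestronglyMeasurable 1
        (Eventually.of_forall fun a => abs_log_one_add_le (abs_inner_le_of_mul_le (hC a) hl' hrC)))
        ((hint l).sub ((hint2 l).div_const 4)) fun a => ?_
      exact log_one_add_le_sub_sq (abs_inner_le_of_mul_le (hC a) hl' hrC)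
    rw [integral_sub (hint l) ((hint2 l).div_const 4), integral_div] at h1
    have h2 := hmean l
    have h3 := hquad l
    rw [heq] at h2 h3
    nlinarith
  refine ⟨l, hlt, fun e => ?_⟩
  obtain ⟨t, ht, htr⟩ : ∃ t > 0, ∀ x : ℝ, |x| < t → ‖l + x • e‖ < r := by
    have hc : ContinuousAt (fun x : ℝ => ‖l + x • e‖) 0 := by fun_prop
    have := hc.eventually (gt_mem_nhds (show ‖l + (0 : ℝ) • e‖ < r by simpa using hlt))
    obtain ⟨t, ht, h⟩ := Metric.eventually_nhds_iff.mp this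
    exact ⟨t, ht, fun x hx => h (by simpa using hx)⟩
  have hin : ∀ x : ℝ, |x| < t → ∀ a, 7 / 8 ≤ 1 + ⟪l + x • e, W a⟫ := fun x hx a => by
    have := abs_le.mp (abs_inner_le_of_mul_le (hC a) (htr x hx).le hrC)
    linarith
  -- Differentiation under the integral along the line `l + x • e`; the denominators stay above
  -- `7/8`, hence the dominating constant `2 ‖e‖ C`.
  have hder := (hasDerivAt_integral_of_dominated_loc_of_deriv_le (μ := ν) (𝕜 := ℝ)
    (F := fun (x : ℝ) a => Real.log (1 + ⟪l + x • e, W a⟫)) (x₀ := 0)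
    (F' := fun (x : ℝ) a => ⟪e, W a⟫ / (1 + ⟪l + x • e, W a⟫))
    (bound := fun _ => 2 * (‖e‖ * C)) (Metric.ball_mem_nhds (0 : ℝ) ht)
    (Eventually.of_forall fun x => (hmeas _).aestronglyMeasurable)
    (Integrable.of_bound (hmeas _).aestronglyMeasurable 1 (Eventually.of_forall fun a =>
      abs_log_one_add_le (abs_inner_le_of_mul_le (hC a) (by simpa using hl') hrC)))
    ((measurable_inner_left hW e).div
      (measurable_const.add (measurable_inner_left hW _))).aestronglyMeasurable
    (Eventually.of_forall fun a x hx => ?_) (integrable_const _)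
    (Eventually.of_forall fun a x hx => ?_)).2
  · have hloc : IsLocalMax (fun x : ℝ => ∫ a, Real.log (1 + ⟪l + x • e, W a⟫) ∂ν) 0 := by
      filter_upwards [Metric.ball_mem_nhds (0 : ℝ) ht] with x hx
      have := hmax (show l + x • e ∈ Metric.closedBall 0 r by
        simpa using (htr x (by simpa using hx)).le)
      simpa [hΦ] using this
    have := hloc.hasDerivAt_eq_zero hder
    simpa using this
  · have h1 := hin x (by simpa using hx) a
    rw [norm_div, div_le_iff₀ (norm_pos_iff.mpr (by linarith)), Real.norm_eq_abs,
      Real.norm_eq_abs, abs_of_pos (by linarith : (0 : ℝ) < 1 + ⟪l + x • e, W a⟫)]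
    have h2 := (abs_real_inner_le_norm e (W a)).trans
      (mul_le_mul_of_nonneg_left (hC a) (norm_nonneg e))
    nlinarith [abs_nonneg ⟪e, W a⟫]
  · have h1 := hin x (by simpa using hx) a
    have h2 : HasDerivAt (fun x : ℝ => 1 + ⟪l + x • e, W a⟫) ⟪e, W a⟫ x := by
      have : (fun x : ℝ => 1 + ⟪l + x • e, W a⟫) = fun x : ℝ => 1 + (⟪l, W a⟫ + x * ⟪e, W a⟫) := by
        funext x; rw [inner_add_left, real_inner_smul_left]
      rw [this]
      simpa using (((hasDerivAt_id x).mul_const ⟪e, W a⟫).const_add ⟪l, W a⟫).const_add 1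
    exact h2.log (by linarith)

/-- Stability of the solution of the first order condition. -/
theorem norm_sub_tilt_le {n : ℕ} {z : Fin n → E w} {C r v s : ℝ} (hs : 0 ≤ s) (hC : ∀ i, ‖z i‖ ≤ C)
    (hrC : r * C ≤ 1 / 8) {l l' : E w} (hl : ‖l‖ ≤ r) (hl' : ‖l'‖ ≤ r)
    (h0 : ∀ e : E w, ∑ i, ⟪e, z i⟫ / (1 + ⟪l, z i⟫) = 0)
    (h1 : ∀ e : E w, |∑ i, ⟪e, z i⟫ / (1 + ⟪l', z i⟫)| ≤ s * ‖e‖)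
    (hquad : ∀ e : E w, v * ‖e‖ ^ 2 ≤ ∑ i, ⟪e, z i⟫ ^ 2) :
    v * ‖l - l'‖ ≤ 2 * s := by
  rcases eq_or_ne l l' with rfl | hne
  · simpa using hs
  have hpos : 0 < ‖l - l'‖ := norm_pos_iff.mpr (sub_ne_zero.mpr hne)
  have key : v * ‖l - l'‖ ^ 2 ≤ 2 * (s * ‖l - l'‖) := by
    -- Strong monotonicity, term by term: `(p - q)/(1 + q) - (p - q)/(1 + p) = (p - q)² / ((1 + p)(1
    -- + q))`, with denominator at most 2.
    have h2 : ∑ i, ⟪l - l', z i⟫ ^ 2 ≤ 2 * (∑ i, ⟪l - l', z i⟫ / (1 + ⟪l', z i⟫) -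
        ∑ i, ⟪l - l', z i⟫ / (1 + ⟪l, z i⟫)) := by
      rw [← Finset.sum_sub_distrib, Finset.mul_sum]
      refine Finset.sum_le_sum fun i _ => ?_
      have ha := abs_le.mp (abs_inner_le_of_mul_le (hC i) hl hrC)
      have hb := abs_le.mp (abs_inner_le_of_mul_le (hC i) hl' hrC)
      rw [inner_sub_left]
      generalize ⟪l, z i⟫ = p at *
      generalize ⟪l', z i⟫ = q at *
      rw [div_sub_div _ _ (by linarith) (by linarith), ← mul_div_assoc, le_div_iff₀ (by nlinarith)]
      have : (1 + q) * (1 + p) ≤ 2 := by nlinarith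
      nlinarith [mul_le_mul_of_nonneg_left this (sq_nonneg (p - q))]
    rw [h0, sub_zero] at h2
    linarith [hquad (l - l'), (le_abs_self _).trans (h1 (l - l'))]
  nlinarith

end Tilt

/-! ### Lagrange duality for the adjustment weights. -/

section Weights

variable {w n : ℕ}

theorem coe_ereal_sum {ι : Type*} (s : Finset ι) (f : ι → ℝ) :
    ((∑ i ∈ s, f i : ℝ) : EReal) = ∑ i ∈ s, (f i : EReal) := by
  classical
  induction s using Finset.induction_on with
  | empty => simp
  | insert a s ha ih => rw [Finset.sum_insert ha, Finset.sum_insert ha, EReal.coe_add, ih]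

theorem logLikelihood_of_pos {q : Fin n → ℝ} (hq : ∀ i, 0 < q i) :
    logLikelihood q = ((∑ i, Real.log (q i) : ℝ) : EReal) := by
  unfold logLikelihood
  rw [coe_ereal_sum]
  refine Finset.sum_congr rfl fun i _ => ?_
  rw [ENNReal.log_ofReal, if_neg (not_le.mpr (hq i))]

theorem pos_of_logLikelihood_ne_bot {q : Fin n → ℝ} (hq : logLikelihood q ≠ ⊥) (i : Fin n) :
    0 < q i := by
  by_contra hi
  refine hq ?_
  unfold logLikelihood
  rw [← Finset.add_sum_erase _ _ (Finset.mem_univ i), ENNReal.log_ofReal, if_pos (not_lt.mp hi),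
    EReal.bot_add]

/-- A solution of the first order condition determines the adjustment weights. -/
theorem adjustmentWeights_eq (K : E w → ℝ) {h : ℝ} (hh : 0 < h) (x : E w) (xs : Fin n → E w)
    (hn : 0 < n) {l : E w}
    (hl : ∀ i, 0 < 1 + ⟪l, K (h⁻¹ • (xs i - x)) • (h⁻¹ • (xs i - x))⟫)
    (h0 : ∀ e : E w, ∑ i, ⟪e, K (h⁻¹ • (xs i - x)) • (h⁻¹ • (xs i - x))⟫ /
      (1 + ⟪l, K (h⁻¹ • (xs i - x)) • (h⁻¹ • (xs i - x))⟫) = 0)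
    {p : Fin n → ℝ}
    (hp : (∃ q, IsAdjustmentWeights K h x xs q) → IsAdjustmentWeights K h x xs p) :
    IsFeasible K h x xs p ∧
    ∀ i, p i = (n * (1 + ⟪l, K (h⁻¹ • (xs i - x)) • (h⁻¹ • (xs i - x))⟫))⁻¹ := by
  set z : Fin n → E w := fun i => K (h⁻¹ • (xs i - x)) • (h⁻¹ • (xs i - x)) with hz
  change ∀ i, 0 < 1 + ⟪l, z i⟫ at hl
  change ∀ e : E w, ∑ i, ⟪e, z i⟫ / (1 + ⟪l, z i⟫) = 0 at h0
  change IsFeasible K h x xs p ∧ ∀ i, p i = (n * (1 + ⟪l, z i⟫))⁻¹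
  have hn' : (0 : ℝ) < n := by exact_mod_cast hn
  -- Up to the nonzero factor `h^{1-w}` the balance constraint is `∑ q_i z_i = 0`.
  have hbal : ∀ q : Fin n → ℝ, ∑ i, (q i * scaledKernel K h (xs i - x)) • (xs i - x) =
      ((h ^ w)⁻¹ * h) • ∑ i, q i • z i := by
    intro q
    rw [Finset.smul_sum]
    refine Finset.sum_congr rfl fun i _ => ?_
    simp only [hz, scaledKernel, smul_smul]
    congr 1
    field_simp
  have hfac : (h ^ w)⁻¹ * h ≠ 0 := by positivity
  set q : Fin n → ℝ := fun i => (n * (1 + ⟪l, z i⟫))⁻¹ with hq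
  have hqpos : ∀ i, 0 < q i := fun i => inv_pos.mpr (mul_pos hn' (hl i))
  have hqfeas : IsFeasible K h x xs q := by
    refine ⟨fun i => (hqpos i).le, ?_, ?_⟩
    -- Total mass one is the first order condition tested against `e = l`.
    · have h1 : ∀ i, q i = (n : ℝ)⁻¹ - (n : ℝ)⁻¹ * (⟪l, z i⟫ / (1 + ⟪l, z i⟫)) := fun i => by
        have := (hl i).ne'
        simp only [hq]
        field_simp
        ring
      simp only [h1]
      rw [Finset.sum_sub_distrib, ← Finset.mul_sum, h0 l]
      simp [hn'.ne']
    · rw [hbal, smul_eq_zero]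
      right
      refine ext_inner_left ℝ fun e => ?_
      rw [inner_sum, inner_zero_right, ← mul_zero (n : ℝ)⁻¹, ← h0 e, Finset.mul_sum]
      refine Finset.sum_congr rfl fun i _ => ?_
      rw [real_inner_smul_right]
      simp only [hq, mul_inv]
      rw [div_eq_mul_inv]
      ring
  -- Both constraints together say that `∑ q'_i / q_i = n ∑ q'_i (1 + ⟨l, z_i⟩) = n` for every
  -- feasible `q'`. With `log t ≤ t - 1` this makes `q` optimal.
  have hratio : ∀ q' : Fin n → ℝ, IsFeasible K h x xs q' → ∑ i, (q' i / q i - 1) = 0 := by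
    intro q' hq'
    have hb : ∑ i, q' i • z i = 0 := by
      have := hq'.balance
      rw [hbal, smul_eq_zero] at this
      exact this.resolve_left hfac
    have hb' : ∑ i, q' i * ⟪l, z i⟫ = 0 := by
      have := congrArg (fun v => ⟪l, v⟫) hb
      simpa [inner_sum, real_inner_smul_right] using this
    have h1 : ∀ i, q' i / q i - 1 = n * q' i + n * (q' i * ⟪l, z i⟫) - 1 := fun i => by
      simp only [hq, div_inv_eq_mul]
      ring
    simp only [h1]
    rw [Finset.sum_sub_distrib, Finset.sum_add_distrib, ← Finset.mul_sum, ← Finset.mul_sum, hb',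
      hq'.sum_one]
    simp
  have hlog : ∀ q' : Fin n → ℝ, (∀ i, 0 < q' i) → ∀ i,
      Real.log (q' i) - Real.log (q i) ≤ q' i / q i - 1 := fun q' hq' i => by
    rw [← Real.log_div (hq' i).ne' (hqpos i).ne']
    exact Real.log_le_sub_one_of_pos (div_pos (hq' i) (hqpos i))
  have hqadj : IsAdjustmentWeights K h x xs q := by
    refine ⟨hqfeas, fun q' hq' => ?_⟩
    by_cases hbot : logLikelihood q' = ⊥
    · rw [hbot]; exact bot_le
    have hpos := pos_of_logLikelihood_ne_bot hbot
    rw [logLikelihood_of_pos hpos, logLikelihood_of_pos hqpos, EReal.coe_le_coe_iff,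
      ← sub_nonpos, ← Finset.sum_sub_distrib]
    exact (Finset.sum_le_sum fun i _ => hlog q' hpos i).trans (hratio q' hq').le
  obtain ⟨hpf, hpm⟩ := hp ⟨q, hqadj⟩
  refine ⟨hpf, fun i => ?_⟩
  have hle := hpm q hqfeas
  have hbot : logLikelihood p ≠ ⊥ := by
    intro hbot
    rw [hbot, logLikelihood_of_pos hqpos] at hle
    exact EReal.coe_ne_bot _ (le_bot_iff.mp hle)
  have hpos := pos_of_logLikelihood_ne_bot hbot
  rw [logLikelihood_of_pos hpos, logLikelihood_of_pos hqpos, EReal.coe_le_coe_iff,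
      ← sub_nonneg, ← Finset.sum_sub_distrib] at hle
  -- Uniqueness: optimality of `p` forces equality in every `log t ≤ t - 1`, and equality holds only
  -- at `t = 1`.
  have hzero : ∑ i, ((p i / q i - 1) - (Real.log (p i) - Real.log (q i))) = 0 := by
    refine le_antisymm ?_ (Finset.sum_nonneg fun i _ => sub_nonneg.mpr (hlog p hpos i))
    rw [Finset.sum_sub_distrib, hratio p hpf]
    linarith
  have hi := (Finset.sum_eq_zero_iff_of_nonneg
    (fun i _ => sub_nonneg.mpr (hlog p hpos i))).mp hzero i (Finset.mem_univ i)
  by_contra hne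
  have h1 : p i / q i ≠ 1 := fun h1 => hne ((div_eq_one_iff_eq (hqpos i).ne').mp h1)
  have := Real.log_lt_sub_one_of_pos (div_pos (hpos i) (hqpos i)) h1
  rw [Real.log_div (hpos i).ne' (hqpos i).ne'] at this
  linarith

end Weights

theorem abs_integral_le {Ω : Type*} {mΩ : MeasurableSpace Ω} {μ : Measure Ω} {f g : Ω → ℝ}
    (hg : Integrable g μ) (h : ∀ ω, |f ω| ≤ g ω) : |∫ ω, f ω ∂μ| ≤ ∫ ω, g ω ∂μ :=
  (abs_integral_le_integral_abs).trans (integral_mono_of_nonneg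
    (Eventually.of_forall fun ω => abs_nonneg (f ω)) hg (Eventually.of_forall h))

/-! ### The covariance inequality for bounded functions. -/

section Covariance

variable {Ω : Type*} {mΩ : MeasurableSpace Ω} {μ : Measure Ω} [IsProbabilityMeasure μ]

/-- The covariance with a bounded `m`-measurable function is controlled by the covariance with an
`m`-measurable event. -/
theorem exists_abs_cov_le {m : MeasurableSpace Ω} (hm : m ≤ mΩ) {f g : Ω → ℝ} {C : ℝ}
    (hf : StronglyMeasurable[m] f) (hfC : ∀ ω, |f ω| ≤ C) (hg : Integrable g μ) :
    ∃ A, MeasurableSet[m] A ∧ |∫ ω, f ω * g ω ∂μ - (∫ ω, f ω ∂μ) * ∫ ω, g ω ∂μ| ≤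
      2 * C * |∫ ω in A, g ω ∂μ - μ.real A * ∫ ω, g ω ∂μ| := by
  set c := ∫ ω, g ω ∂μ with hc
  set g' : Ω → ℝ := fun ω => g ω - c with hg'
  have hg'i : Integrable g' μ := hg.sub (integrable_const c)
  set d : Ω → ℝ := μ[g' | m] with hd
  have hdm : StronglyMeasurable[m] d := stronglyMeasurable_condExp
  have hdi : Integrable d μ := integrable_condExp
  have hfm : AEStronglyMeasurable[mΩ] f μ := (hf.mono hm).aestronglyMeasurable
  have hfg : Integrable (fun ω => f ω * g ω) μ :=
    hg.bdd_mul hfm (Eventually.of_forall fun ω => hfC ω)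
  have hfg' : Integrable (f * g') μ :=
    hg'i.bdd_mul hfm (Eventually.of_forall fun ω => hfC ω)
  have hfi : Integrable f μ := Integrable.of_bound hfm C (Eventually.of_forall fun ω => hfC ω)
  have h1 : ∫ ω, f ω * g ω ∂μ - (∫ ω, f ω ∂μ) * c = ∫ ω, f ω * d ω ∂μ := by
    have e1 : ∫ ω, f ω * g ω ∂μ - (∫ ω, f ω ∂μ) * c = ∫ ω, (f * g') ω ∂μ := by
      rw [← integral_mul_const, ← integral_sub hfg (hfi.mul_const c)]
      refine integral_congr_ae (Eventually.of_forall fun ω => ?_)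
      simp only [hg', Pi.mul_apply]; ring
    rw [e1, ← integral_condExp hm]
    exact integral_congr_ae (condExp_mul_of_stronglyMeasurable_left hf hfg' hg'i)
  -- The covariance equals `∫ f d` and is at most `C ∫ |d|`. Since `d` has mean zero, `∫ |d|` is
  -- twice the integral of `d` over the event where it is positive.
  set A : Set Ω := {ω | 0 < d ω} with hA
  have hAm : MeasurableSet[m] A := measurableSet_lt measurable_const hdm.measurable
  have h2 : ∫ ω in A, d ω ∂μ = ∫ ω in A, g ω ∂μ - μ.real A * c := by
    rw [hd, setIntegral_condExp hm hg'i hAm, hg',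
      integral_sub hg.integrableOn (integrable_const c).integrableOn]
    simp
  have h3 : ∫ ω, d ω ∂μ = 0 := by
    rw [hd, integral_condExp hm, hg', integral_sub hg (integrable_const c)]
    simp [hc]
  have h4 : ∫ ω, |d ω| ∂μ = 2 * ∫ ω in A, d ω ∂μ := by
    rw [← integral_indicator (hm _ hAm), ← sub_zero (2 * _), ← h3, ← integral_const_mul,
      ← integral_sub ((hdi.indicator (hm _ hAm)).const_mul 2) hdi]
    refine integral_congr_ae (Eventually.of_forall fun ω => ?_)
    by_cases hω : 0 < d ω
    · simp only [Set.indicator_of_mem (show ω ∈ A from hω), abs_of_pos hω]; ring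
    · simp only [Set.indicator_of_notMem (show ω ∉ A from hω), abs_of_nonpos (not_lt.mp hω)]; ring
  refine ⟨A, hAm, ?_⟩
  rw [h1, ← h2]
  calc |∫ ω, f ω * d ω ∂μ| ≤ ∫ ω, C * |d ω| ∂μ := by
        refine abs_integral_le (hdi.abs.const_mul C) fun ω => ?_
        rw [abs_mul]
        exact mul_le_mul_of_nonneg_right (hfC ω) (abs_nonneg _)
    _ = 2 * C * ∫ ω in A, d ω ∂μ := by rw [integral_const_mul, h4]; ring
    _ ≤ 2 * C * |∫ ω in A, d ω ∂μ| := by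
        obtain ⟨ω⟩ : Nonempty Ω := nonempty_of_isProbabilityMeasure μ
        have := (abs_nonneg _).trans (hfC ω)
        gcongr
        exact le_abs_self _

/-- The covariance inequality for bounded functions of strongly mixing σ-algebras. -/
theorem abs_cov_le_of_mixing {m₁ m₂ : MeasurableSpace Ω} (hm₁ : m₁ ≤ mΩ) (hm₂ : m₂ ≤ mΩ)
    {f g : Ω → ℝ} {C a : ℝ} (hf : StronglyMeasurable[m₁] f) (hfC : ∀ ω, |f ω| ≤ C)
    (hg : StronglyMeasurable[m₂] g) (hgC : ∀ ω, |g ω| ≤ C)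
    (ha : ∀ A B, MeasurableSet[m₁] A → MeasurableSet[m₂] B →
      |μ.real (A ∩ B) - μ.real A * μ.real B| ≤ a) :
    |∫ ω, f ω * g ω ∂μ - (∫ ω, f ω ∂μ) * ∫ ω, g ω ∂μ| ≤ 4 * C ^ 2 * a := by
  obtain ⟨ω⟩ : Nonempty Ω := nonempty_of_isProbabilityMeasure μ
  have hC : 0 ≤ C := (abs_nonneg _).trans (hfC ω)
  have hgi : Integrable g μ := Integrable.of_bound (hg.mono hm₂).aestronglyMeasurable C
    (Eventually.of_forall fun ω => hgC ω)
  obtain ⟨A, hA, hle⟩ := exists_abs_cov_le hm₁ hf hfC hgi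
  have hA' := hm₁ _ hA
  have h1i : Integrable (A.indicator fun _ => (1 : ℝ)) μ := (integrable_const 1).indicator hA'
  -- The same reduction with the roles exchanged, now against the indicator of `A`; the two factors
  -- `2 C` give `4 C²`.
  obtain ⟨B, hB, hle'⟩ := exists_abs_cov_le hm₂ hg hgC h1i
  have hB' := hm₂ _ hB
  have e1 : ∫ ω, g ω * A.indicator (fun _ => (1 : ℝ)) ω ∂μ = ∫ ω in A, g ω ∂μ := by
    rw [← integral_indicator hA']
    refine integral_congr_ae (Eventually.of_forall fun ω => ?_)
    by_cases hω : ω ∈ A <;> simp [hω]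
  have e2 : ∫ ω, A.indicator (fun _ => (1 : ℝ)) ω ∂μ = μ.real A := by
    rw [integral_indicator_const _ hA']; simp
  have e3 : ∫ ω in B, A.indicator (fun _ => (1 : ℝ)) ω ∂μ = μ.real (A ∩ B) := by
    rw [integral_indicator_const _ hA', measureReal_restrict_apply hA']; simp
  rw [e1, e2, e3, mul_comm (∫ ω, g ω ∂μ), mul_comm (μ.real B)] at hle'
  calc _ ≤ _ := hle
    _ ≤ 2 * C * (2 * C * |μ.real (A ∩ B) - μ.real A * μ.real B|) := by gcongr
    _ ≤ 2 * C * (2 * C * a) := by gcongr; exact ha A B hA hB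
    _ = _ := by ring

end Covariance

/-! ### Mixing coefficients and stationarity. -/

section Mixing

variable {Ω S : Type*} {mΩ : MeasurableSpace Ω} [MeasurableSpace S] {μ : Measure Ω}
  [IsProbabilityMeasure μ] {V : ℕ → Ω → S}

theorem abs_sub_mul_le_one (A B : Set Ω) : |μ.real (A ∩ B) - μ.real A * μ.real B| ≤ 1 := by
  have h1 := measureReal_nonneg (μ := μ) (s := A ∩ B)
  have h2 := measureReal_nonneg (μ := μ) (s := A)
  have h3 := measureReal_nonneg (μ := μ) (s := B)
  have h4 := measureReal_le_one (μ := μ) (s := A ∩ B)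
  have h5 := measureReal_le_one (μ := μ) (s := A)
  have h6 := measureReal_le_one (μ := μ) (s := B)
  rw [abs_le]
  constructor <;> nlinarith

theorem bddAbove_alphaMixing (τ : ℕ) :
    BddAbove {r : ℝ | ∃ (k : ℕ) (A B : Set Ω), MeasurableSet[past V k] A ∧
      MeasurableSet[future V (k + τ)] B ∧ r = |μ.real (A ∩ B) - μ.real A * μ.real B|} := by
  refine ⟨1, ?_⟩
  rintro _ ⟨k, A, B, _, _, rfl⟩
  exact abs_sub_mul_le_one A B

theorem le_alphaMixing {k τ : ℕ} {A B : Set Ω} (hA : MeasurableSet[past V k] A)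
    (hB : MeasurableSet[future V (k + τ)] B) :
    |μ.real (A ∩ B) - μ.real A * μ.real B| ≤ alphaMixing μ V τ :=
  le_csSup (bddAbove_alphaMixing τ) ⟨k, A, B, hA, hB, rfl⟩

theorem alphaMixing_le_one (τ : ℕ) : alphaMixing μ V τ ≤ 1 := by
  refine csSup_le ⟨_, 0, ∅, ∅, @MeasurableSet.empty _ (past V 0),
    @MeasurableSet.empty _ (future V (0 + τ)), rfl⟩ ?_
  rintro _ ⟨k, A, B, _, _, rfl⟩
  exact abs_sub_mul_le_one A B

/-- The decay `τ^{-2}` suffices for the variance bound since the summands are bounded. The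
asymptotic rate covers lags from some `N` on; for smaller lags `α ≤ 1 ≤ N² / τ²`. -/
theorem exists_alphaMixing_le {δ : ℝ} (hδ : 0 < δ)
    (hrate : alphaMixing μ V =O[atTop] fun τ : ℕ => (τ : ℝ) ^ (-(2 + δ))) :
    ∃ B : ℝ, 0 < B ∧ ∀ τ : ℕ, 1 ≤ τ → alphaMixing μ V τ ≤ B / (τ : ℝ) ^ 2 := by
  obtain ⟨c, hc⟩ := hrate.bound
  obtain ⟨N, hN⟩ := eventually_atTop.mp hc
  refine ⟨|c| + (N : ℝ) ^ 2 + 1, by positivity, fun τ hτ => ?_⟩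
  have hτ' : (1 : ℝ) ≤ τ := by exact_mod_cast hτ
  rw [le_div_iff₀ (by positivity)]
  rcases le_total N τ with h | h
  · have h1 := (le_abs_self _).trans (hN τ h)
    rw [Real.norm_of_nonneg (by positivity)] at h1
    have h2 : (τ : ℝ) ^ (-(2 + δ)) ≤ ((τ : ℝ) ^ 2)⁻¹ := by
      rw [← Real.rpow_natCast, ← Real.rpow_neg (by positivity)]
      exact Real.rpow_le_rpow_of_exponent_le hτ' (by push_cast; linarith)
    have h3 : alphaMixing μ V τ ≤ |c| * ((τ : ℝ) ^ 2)⁻¹ :=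
      h1.trans (mul_le_mul (le_abs_self c) h2 (by positivity) (abs_nonneg c))
    rw [← div_eq_mul_inv, le_div_iff₀ (by positivity)] at h3
    nlinarith [sq_nonneg (N : ℝ)]
  · have h1 := alphaMixing_le_one (μ := μ) (V := V) τ
    have h2 : (τ : ℝ) ^ 2 ≤ (N : ℝ) ^ 2 := by gcongr
    nlinarith [abs_nonneg c, sq_nonneg (τ : ℝ)]

theorem abs_cov_le_alphaMixing (hV : ∀ i, Measurable (V i)) {f : S → ℝ} (hf : Measurable f)
    {C : ℝ} (hfC : ∀ z, |f z| ≤ C) (i τ : ℕ) :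
    |∫ ω, f (V i ω) * f (V (i + τ) ω) ∂μ - (∫ ω, f (V i ω) ∂μ) * ∫ ω, f (V (i + τ) ω) ∂μ| ≤
      4 * C ^ 2 * alphaMixing μ V τ := by
  have h1 : MeasurableSpace.comap (V i) inferInstance ≤ past V i := le_iSup₂_of_le i le_rfl le_rfl
  have h2 : MeasurableSpace.comap (V (i + τ)) inferInstance ≤ future V (i + τ) :=
    le_iSup₂_of_le (i + τ) le_rfl le_rfl
  refine abs_cov_le_of_mixing (iSup₂_le fun j _ => (hV j).comap_le)
    (iSup₂_le fun j _ => (hV j).comap_le) (m₁ := past V i) (m₂ := future V (i + τ))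
    (f := fun ω => f (V i ω)) (g := fun ω => f (V (i + τ) ω))
    ?_ (fun _ => hfC _) ?_ (fun _ => hfC _) fun A B hA hB => le_alphaMixing hA hB
  · exact ((hf.comp (comap_measurable (V i))).mono h1 le_rfl).stronglyMeasurable
  · exact ((hf.comp (comap_measurable (V (i + τ)))).mono h2 le_rfl).stronglyMeasurable

omit [IsProbabilityMeasure μ] in
theorem IsStationary.map_eq (hs : IsStationary μ V) (hV : ∀ i, Measurable (V i)) (i τ : ℕ) :
    μ.map (fun ω => (V i ω, V (i + τ) ω)) = μ.map (fun ω => (V 0 ω, V τ ω)) := by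
  have hpair : Measurable fun v : ℕ → S => (v 0, v τ) :=
    (measurable_pi_apply 0).prodMk (measurable_pi_apply τ)
  have h := congrArg (Measure.map fun v : ℕ → S => (v 0, v τ)) (hs i)
  rw [Measure.map_map hpair (measurable_pi_lambda _ fun j => hV _),
    Measure.map_map hpair (measurable_pi_lambda _ fun j => hV _)] at h
  simpa [Function.comp_def, add_comm] using h

omit [IsProbabilityMeasure μ] in
theorem IsStationary.integral_eq (hs : IsStationary μ V) (hV : ∀ i, Measurable (V i))
    {f : S → ℝ} (hf : Measurable f) (i : ℕ) : ∫ ω, f (V i ω) ∂μ = ∫ ω, f (V 0 ω) ∂μ := by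
  have h := congrArg (Measure.map Prod.fst) (hs.map_eq hV i 0)
  rw [Measure.map_map measurable_fst ((hV _).prodMk (hV _)),
    Measure.map_map measurable_fst ((hV _).prodMk (hV _))] at h
  have h' : μ.map (V i) = μ.map (V 0) := h
  rw [← integral_map (hV i).aemeasurable hf.aestronglyMeasurable, h',
    integral_map (hV 0).aemeasurable hf.aestronglyMeasurable]

end Mixing

/-- A sum of minima of a constant and an inverse square. -/
theorem sum_le_of_le_sq_of_le_div_sq {c : ℕ → ℝ} {a A b : ℝ} (ha : 0 < a) (hA : 0 ≤ A)
    (hb : 0 ≤ b) (n : ℕ) (h1 : ∀ l, 1 ≤ l → c l ≤ A * a ^ 2)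
    (h2 : ∀ l : ℕ, 1 ≤ l → c l ≤ b / (l : ℝ) ^ 2) :
    ∑ l ∈ Finset.Ico 1 n, c l ≤ (A * (1 + a) + 2 * b) * a := by
  -- The two bounds balance near lag `1 / a`: up to `J` the constant bound contributes about `J a² ≈
  -- a`, beyond `J` the tail of the inverse squares is at most `2 / (J + 1) ≤ 2 a`.
  set J := ⌈1 / a⌉₊ with hJ
  have hJ1 : 1 / a ≤ J := Nat.le_ceil _
  have hJ2 : (J : ℝ) < 1 / a + 1 := Nat.ceil_lt_add_one (by positivity)
  have hstep : ∑ l ∈ Finset.Ico 1 n, c l ≤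
      ∑ l ∈ Finset.Ico 1 n, if l < J + 1 then A * a ^ 2 else b * ((l : ℝ) ^ 2)⁻¹ := by
    refine Finset.sum_le_sum fun l hl => ?_
    have hl' := (Finset.mem_Ico.mp hl).1
    split_ifs
    · exact h1 l hl'
    · exact (h2 l hl').trans (div_eq_mul_inv _ _).le
  rw [Finset.sum_ite] at hstep
  have e1 : ∑ l ∈ Finset.Ico 1 n with l < J + 1, A * a ^ 2 ≤ J * (A * a ^ 2) := by
    refine (Finset.sum_le_sum_of_subset_of_nonneg (t := Finset.Ico 1 (J + 1)) ?_
      fun _ _ _ => by positivity).trans ?_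
    · intro l hl
      simp only [Finset.mem_filter, Finset.mem_Ico] at hl ⊢
      omega
    · simp
  have e2 : ∑ l ∈ Finset.Ico 1 n with ¬ l < J + 1, b * ((l : ℝ) ^ 2)⁻¹ ≤ b * (2 / (J + 1)) := by
    refine (Finset.sum_le_sum_of_subset_of_nonneg (t := Finset.Ioo J n) ?_
      fun _ _ _ => by positivity).trans ?_
    · intro l hl
      simp only [Finset.mem_filter, Finset.mem_Ico, Finset.mem_Ioo] at hl ⊢
      omega
    · rw [← Finset.mul_sum]
      exact mul_le_mul_of_nonneg_left (sum_Ioo_inv_sq_le J n) hb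
  have e3 : (J : ℝ) * (A * a ^ 2) ≤ A * (1 + a) * a := by
    have : (J : ℝ) * a ≤ 1 + a := by
      calc (J : ℝ) * a ≤ (1 / a + 1) * a := by gcongr
        _ = 1 + a := by field_simp
    calc (J : ℝ) * (A * a ^ 2) = A * ((J : ℝ) * a) * a := by ring
      _ ≤ _ := by gcongr
  have e4 : b * (2 / ((J : ℝ) + 1)) ≤ 2 * b * a := by
    have : 2 / ((J : ℝ) + 1) ≤ 2 * a := by
      rw [div_le_iff₀ (by positivity)]
      rw [div_le_iff₀ ha] at hJ1
      nlinarith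
    nlinarith
  linarith

/-- Each row is split at the diagonal, and each half is dominated by the full sum of `c` over lags.
-/
theorem sum_sum_le_of_shift_bound {F : ℕ → ℕ → ℝ} {c : ℕ → ℝ} (hc : ∀ l, 0 ≤ c l)
    (hsymm : ∀ i j, F i j = F j i) (hF : ∀ i l, F i (i + l) ≤ c l) (n : ℕ) :
    ∑ i ∈ Finset.range n, ∑ j ∈ Finset.range n, F i j ≤
      n * (2 * ∑ l ∈ Finset.range n, c l) := by
  have hrow : ∀ i ∈ Finset.range n, ∑ j ∈ Finset.range n, F i j ≤
      2 * ∑ l ∈ Finset.range n, c l := by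
    intro i hi
    have hi' := Finset.mem_range.mp hi
    rw [← Finset.sum_range_add_sum_Ico _ hi'.le, two_mul]
    refine add_le_add ?_ ?_
    · rw [← Finset.sum_range_reflect]
      calc ∑ j ∈ Finset.range i, F i (i - 1 - j) ≤ ∑ j ∈ Finset.range i, c (j + 1) := by
            refine Finset.sum_le_sum fun j hj => ?_
            have hj' := Finset.mem_range.mp hj
            rw [hsymm]
            have := hF (i - 1 - j) (j + 1)
            rwa [show i - 1 - j + (j + 1) = i by omega] at this
        -- The left half contains only lags from 1 on; adding `c 0 ≥ 0` completes the range, at the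
        -- price of counting the diagonal twice.
        _ ≤ ∑ j ∈ Finset.range i, c (j + 1) + c 0 := le_add_of_nonneg_right (hc 0)
        _ = ∑ j ∈ Finset.range (i + 1), c j := (Finset.sum_range_succ' _ _).symm
        _ ≤ _ := Finset.sum_le_sum_of_subset_of_nonneg (Finset.range_subset_range.mpr hi')
            fun _ _ _ => hc _
    · rw [Finset.sum_Ico_eq_sum_range]
      exact (Finset.sum_le_sum fun l _ => hF i l).trans
        (Finset.sum_le_sum_of_subset_of_nonneg
          (Finset.range_subset_range.mpr (Nat.sub_le n i)) fun _ _ _ => hc _)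
  calc _ ≤ ∑ i ∈ Finset.range n, 2 * ∑ l ∈ Finset.range n, c l := Finset.sum_le_sum hrow
    _ = _ := by simp

/-! ### Variance of sums of localized functions. -/

section Variance

variable {Ω S : Type*} {mΩ : MeasurableSpace Ω} [MeasurableSpace S] {μ : Measure Ω}
  [IsProbabilityMeasure μ] {V : ℕ → Ω → S}

/-- The variance of a sum of bounded functions of a stationary mixing process that vanish outside a
set of probability of order `a` is of order `n a`. -/
theorem variance_sum_le (hs : IsStationary μ V) (hV : ∀ i, Measurable (V i)) {B : ℝ} (hB0 : 0 ≤ B)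
    (hB : ∀ τ : ℕ, 1 ≤ τ → alphaMixing μ V τ ≤ B / (τ : ℝ) ^ 2)
    {f : S → ℝ} (hf : Measurable f) {C : ℝ} (hfC : ∀ z, |f z| ≤ C) {D : Set S}
    (hD : MeasurableSet D) (hfD : ∀ z, z ∉ D → f z = 0) {A a : ℝ} (hA : 0 ≤ A) (ha : 0 < a)
    (ha1 : a ≤ 1)
    (h1 : μ.real (V 0 ⁻¹' D) ≤ A * a)
    (h2 : ∀ l : ℕ, 1 ≤ l → μ.real (V 0 ⁻¹' D ∩ V l ⁻¹' D) ≤ A * a ^ 2) (n : ℕ) :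
    Var[fun ω => ∑ i ∈ Finset.range n, f (V i ω); μ] ≤
      (6 * C ^ 2 * (A + A ^ 2) + 16 * C ^ 2 * B) * (n * a) := by
  have hLp : ∀ i, MemLp (fun ω => f (V i ω)) 2 μ := fun i =>
    MemLp.of_bound (hf.comp (hV i)).aestronglyMeasurable C (Eventually.of_forall fun _ => hfC _)
  have hC : 0 ≤ C := by
    obtain ⟨ω⟩ : Nonempty Ω := nonempty_of_isProbabilityMeasure μ
    exact (abs_nonneg _).trans (hfC (V 0 ω))
  set m := ∫ ω, f (V 0 ω) ∂μ with hm
  -- By stationarity of pairs, `c l` is the absolute covariance at lag `l` from any starting time.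
  set c : ℕ → ℝ := fun l => |∫ ω, f (V 0 ω) * f (V l ω) ∂μ - m * m| with hc
  have hcov : ∀ i l, cov[fun ω => f (V i ω), fun ω => f (V (i + l) ω); μ] ≤ c l := by
    intro i l
    rw [covariance_eq_sub (hLp i) (hLp (i + l)), hs.integral_eq hV hf i,
      hs.integral_eq hV hf (i + l)]
    refine (le_abs_self _).trans (le_of_eq ?_)
    have hmeas : Measurable fun z : S × S => f z.1 * f z.2 :=
      (hf.comp measurable_fst).mul (hf.comp measurable_snd)
    have h := congrArg (fun ν : Measure (S × S) => ∫ z, f z.1 * f z.2 ∂ν) (hs.map_eq hV i l)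
    rw [integral_map ((hV _).prodMk (hV _)).aemeasurable hmeas.aestronglyMeasurable,
      integral_map ((hV _).prodMk (hV _)).aemeasurable hmeas.aestronglyMeasurable] at h
    simp only [hc, ← h, Pi.mul_apply, hm]
  have hm' : |m| ≤ C * (A * a) := by
    calc |m| ≤ ∫ ω, (V 0 ⁻¹' D).indicator (fun _ => C) ω ∂μ := by
          refine abs_integral_le
            ((integrable_const C).indicator (hV 0 hD)) (fun ω => ?_)
          by_cases hω : V 0 ω ∈ D
          · simpa [Set.indicator_of_mem (show ω ∈ V 0 ⁻¹' D from hω)] using hfC (V 0 ω)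
          · simp [hω, hfD _ hω]
      _ = C * μ.real (V 0 ⁻¹' D) := by
          rw [integral_indicator_const _ (hV 0 hD)]; simp [mul_comm]
      _ ≤ _ := by gcongr
  have hmm : |m * m| ≤ C ^ 2 * A ^ 2 * a ^ 2 := by
    rw [abs_mul]
    calc |m| * |m| ≤ (C * (A * a)) * (C * (A * a)) := by gcongr
      _ = _ := by ring
  have hprod : ∀ l, |∫ ω, f (V 0 ω) * f (V l ω) ∂μ| ≤
      C ^ 2 * μ.real (V 0 ⁻¹' D ∩ V l ⁻¹' D) := by
    intro l
    have hDl : MeasurableSet (V 0 ⁻¹' D ∩ V l ⁻¹' D) := (hV 0 hD).inter (hV l hD)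
    calc |∫ ω, f (V 0 ω) * f (V l ω) ∂μ|
        ≤ ∫ ω, (V 0 ⁻¹' D ∩ V l ⁻¹' D).indicator (fun _ => C ^ 2) ω ∂μ := by
          refine abs_integral_le
            ((integrable_const _).indicator hDl) (fun ω => ?_)
          by_cases hω : ω ∈ V 0 ⁻¹' D ∩ V l ⁻¹' D
          · simp only [Set.indicator_of_mem hω, abs_mul, sq]
            exact mul_le_mul (hfC _) (hfC _) (abs_nonneg _) hC
          · simp only [Set.indicator_of_notMem hω]
            by_cases h0 : V 0 ω ∈ D
            · have : V l ω ∉ D := fun h => hω ⟨h0, h⟩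
              simp [hfD _ this]
            · simp [hfD _ h0]
      _ = _ := by rw [integral_indicator_const _ hDl]; simp [mul_comm]
  -- The diagonal is of order `a` only, since no second factor is available; off the diagonal the
  -- joint probability gives `a²`.
  have hc0 : c 0 ≤ C ^ 2 * (A + A ^ 2) * a := by
    have h := hprod 0
    rw [Set.inter_self] at h
    have h3 : a ^ 2 ≤ a := by nlinarith
    calc c 0 ≤ |∫ ω, f (V 0 ω) * f (V 0 ω) ∂μ| + |m * m| := abs_sub _ _
      _ ≤ C ^ 2 * (A * a) + C ^ 2 * A ^ 2 * a := by
          refine add_le_add (h.trans (by gcongr)) (hmm.trans (by gcongr))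
      _ = _ := by ring
  have hcl : ∀ l, 1 ≤ l → c l ≤ C ^ 2 * (A + A ^ 2) * a ^ 2 := by
    intro l hl
    calc c l ≤ |∫ ω, f (V 0 ω) * f (V l ω) ∂μ| + |m * m| := abs_sub _ _
      _ ≤ C ^ 2 * (A * a ^ 2) + C ^ 2 * A ^ 2 * a ^ 2 := by
          refine add_le_add ((hprod l).trans ?_) hmm
          have := h2 l hl
          gcongr
      _ = _ := by ring
  have hcl' : ∀ l : ℕ, 1 ≤ l → c l ≤ 4 * C ^ 2 * B / (l : ℝ) ^ 2 := by
    intro l hl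
    have h := abs_cov_le_alphaMixing (μ := μ) hV hf hfC 0 l
    rw [zero_add, hs.integral_eq hV hf l] at h
    refine h.trans ?_
    rw [mul_div_assoc]
    gcongr
    exact hB l hl
  -- One multiple of `C² (A + A²) a` comes from lag zero, at most two from the short lags because `1
  -- + a ≤ 2`, and `8 C² B a` from the tail.
  have hsum : ∑ l ∈ Finset.range n, c l ≤
      (3 * C ^ 2 * (A + A ^ 2) + 8 * C ^ 2 * B) * a := by
    have h := sum_le_of_le_sq_of_le_div_sq ha (by positivity) (by positivity) n hcl hcl'
    have h3 : ∑ l ∈ Finset.range n, c l ≤ c 0 + ∑ l ∈ Finset.Ico 1 n, c l := by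
      rcases Nat.eq_zero_or_pos n with rfl | hn
      · simp [hc]
      · rw [Finset.range_eq_Ico, Finset.sum_eq_sum_Ico_succ_bot hn]
    have h4 : C ^ 2 * (A + A ^ 2) * (1 + a) ≤ C ^ 2 * (A + A ^ 2) * 2 := by gcongr; linarith
    nlinarith [mul_le_mul_of_nonneg_right h4 ha.le]
  calc Var[fun ω => ∑ i ∈ Finset.range n, f (V i ω); μ]
      = ∑ i ∈ Finset.range n, ∑ j ∈ Finset.range n,
          cov[fun ω => f (V i ω), fun ω => f (V j ω); μ] := by
        have h := variance_sum' (μ := μ) (s := Finset.range n) (X := fun i ω => f (V i ω))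
          fun i _ => hLp i
        rw [← h]
        congr 1
        ext ω
        simp
    _ ≤ n * (2 * ∑ l ∈ Finset.range n, c l) :=
        sum_sum_le_of_shift_bound (fun l => abs_nonneg _) (fun i j => covariance_comm _ _) hcov n
    _ ≤ n * (2 * ((3 * C ^ 2 * (A + A ^ 2) + 8 * C ^ 2 * B) * a)) := by gcongr
    _ = _ := by ring

end Variance

/-! ### Densities and small balls. -/

section Density

variable {Ω S : Type*} [MeasurableSpace Ω] {μ : Measure Ω}

theorem HasDensity.measureReal_preimage_le [MeasureSpace S] {Z : Ω → S} {f : S → ℝ}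
    (hf : HasDensity μ Z f) (hZ : Measurable Z) {D : Set S} (hD : MeasurableSet D)
    (hvol : volume D ≠ ⊤) {c : ℝ} (hc : 0 ≤ c) (hfc : ∀ z ∈ D, f z ≤ c) :
    μ.real (Z ⁻¹' D) ≤ c * volume.real D := by
  have h1 : μ (Z ⁻¹' D) ≤ ENNReal.ofReal c * volume D := by
    rw [← Measure.map_apply hZ hD, hf.2.2, withDensity_apply _ hD, ← setLIntegral_const]
    exact setLIntegral_mono measurable_const fun z hz => ENNReal.ofReal_le_ofReal (hfc z hz)
  have h2 := ENNReal.toReal_mono (ENNReal.mul_ne_top ENNReal.ofReal_ne_top hvol) h1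
  rwa [ENNReal.toReal_mul, ENNReal.toReal_ofReal hc] at h2

theorem HasDensity.integral_comp [MeasureSpace S] {Z : Ω → S} {f : S → ℝ}
    (hf : HasDensity μ Z f) (hZ : Measurable Z) {φ : S → ℝ} (hφ : Measurable φ) :
    ∫ ω, φ (Z ω) ∂μ = ∫ z, f z * φ z := by
  rw [← integral_map hZ.aemeasurable hφ.aestronglyMeasurable, hf.2.2,
    integral_withDensity_eq_integral_toReal_smul hf.1.ennreal_ofReal
      (Eventually.of_forall fun _ => ENNReal.ofReal_lt_top)]
  refine integral_congr_ae (Eventually.of_forall fun z => ?_)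
  simp [ENNReal.toReal_ofReal (hf.2.1 z)]

theorem volume_real_closedBall {w : ℕ} (x : E w) {r : ℝ} (hr : 0 ≤ r) :
    volume.real (Metric.closedBall x r) = r ^ w * volume.real (Metric.ball (0 : E w) 1) := by
  rw [Measure.real, Measure.addHaar_closedBall _ _ hr, ENNReal.toReal_mul,
    ENNReal.toReal_ofReal (by positivity), finrank_euclideanSpace_fin, Measure.real]

end Density

/-! ### Consequences of the bandwidth conditions. -/

section Bandwidth

variable {w : ℕ} {δ : ℝ} {h : ℕ → ℝ}

/-- Once `h < 1`, raising the exponent from `w` to `w (1 + 2/δ)` makes the power smaller. -/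
theorem BandwidthAssumption.tendsto_mul_pow (hh : BandwidthAssumption w δ h) (hδ : 0 < δ) :
    Tendsto (fun n : ℕ => (n : ℝ) * h n ^ w) atTop atTop := by
  refine tendsto_atTop_mono' _ ?_ hh.tendsto_top
  filter_upwards [hh.tendsto_zero.eventually (gt_mem_nhds zero_lt_one)] with n hn
  have h0 := hh.pos n
  rw [← Real.rpow_natCast (h n) w]
  refine mul_le_mul_of_nonneg_left ?_ (Nat.cast_nonneg n)
  refine Real.rpow_le_rpow_of_exponent_ge h0 hn.le ?_
  have : 0 < 2 / δ := by positivity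
  nlinarith [Nat.cast_nonneg (α := ℝ) w]

theorem BandwidthAssumption.eventually_mul_lt (hh : BandwidthAssumption w δ h) (R : ℝ) {ρ : ℝ}
    (hρ : 0 < ρ) : ∀ᶠ n in atTop, R * h n < ρ := by
  have := hh.tendsto_zero.const_mul R
  rw [mul_zero] at this
  exact this.eventually (gt_mem_nhds hρ)

end Bandwidth

/-! ### Means and variances of kernel sums. -/

section Limits

variable {Ω : Type*} [MeasurableSpace Ω] {μ : Measure Ω} [IsProbabilityMeasure μ] {w : ℕ}
  {X : ℕ → Ω → E w} {Y : ℕ → Ω → ℝ} {δ : ℝ} {g : E w → ℝ} {G : ℕ → E w × E w → ℝ} {x : E w}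
  {h : ℕ → ℝ}

-- Bochner's lemma under continuity of `g` at `x` alone: after the substitution `z = x + h u` the
-- compact support of `φ` confines the integral to a ball on which `g` is close to `g x`.
omit [IsProbabilityMeasure μ] in
theorem tendsto_mean (hX : Measurable (X 0)) (hg : HasDensity μ (X 0) g) (hgx : ContinuousAt g x)
    (hh : BandwidthAssumption w δ h) {φ : E w → ℝ} (hφ : Continuous φ)
    (hφs : HasCompactSupport φ) :
    Tendsto (fun n => (h n ^ w)⁻¹ * ∫ ω, φ ((h n)⁻¹ • (X 0 ω - x)) ∂μ) atTop
      (𝓝 (g x * ∫ u, φ u)) := by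
  have hφi : Integrable φ := hφ.integrable_of_hasCompactSupport hφs
  obtain ⟨R, hR⟩ : ∃ R, ∀ u, R < ‖u‖ → φ u = 0 := by
    obtain ⟨R, hR⟩ := hφs.isCompact.isBounded.exists_norm_le
    exact ⟨R, fun u hu => image_eq_zero_of_notMem_tsupport fun hmem =>
      absurd (hR u hmem) (not_le.mpr hu)⟩
  have hchange : ∀ (a : ℝ) (_ : 0 < a) (ψ : E w → ℝ),
      ∫ z, ψ (a⁻¹ • (z - x)) = a ^ w * ∫ u, ψ u := by
    intro a ha ψ
    rw [integral_sub_right_eq_self (fun z => ψ (a⁻¹ • z)) x, Measure.integral_comp_smul]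
    simp [abs_of_pos ha]
  rw [Metric.tendsto_nhds]
  intro ε hε
  set I := ∫ u, |φ u| with hI
  have hI0 : 0 ≤ I := integral_nonneg fun u => abs_nonneg _
  -- The `+ 1` keeps the final estimate `η I < ε` strict and covers `I = 0`.
  set η := ε / (2 * (I + 1)) with hη
  have hη0 : 0 < η := by positivity
  obtain ⟨ρ, hρ, hball⟩ := Metric.continuousAt_iff.mp hgx η hη0
  filter_upwards [hh.eventually_mul_lt R hρ] with n hn
  have h0 := hh.pos n
  set ψ : E w → ℝ := fun z => φ ((h n)⁻¹ • (z - x)) with hψ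
  have hψi : Integrable ψ := by
    have := (hφi.comp_smul (inv_ne_zero h0.ne')).comp_sub_right x
    exact this
  have hpt : ∀ z, |g z * ψ z - g x * ψ z| ≤ η * |ψ z| := by
    intro z
    rw [← sub_mul, abs_mul]
    by_cases hz : ‖z - x‖ ≤ R * h n
    · refine mul_le_mul_of_nonneg_right ?_ (abs_nonneg _)
      have := hball (x := z) (by rw [dist_eq_norm]; linarith)
      exact (by simpa [Real.dist_eq] using this.le)
    · have : ψ z = 0 := hR _ (by
        rw [norm_smul, norm_inv, Real.norm_of_nonneg h0.le, ← div_eq_inv_mul, lt_div_iff₀ h0]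
        exact not_le.mp hz)
      simp [this]
  -- No global bound on `g` is assumed; integrability of `g ψ` is recovered from that of the
  -- difference, which is dominated by `η |ψ|`.
  have hdiffi : Integrable fun z => g z * ψ z - g x * ψ z := by
    refine (hψi.abs.const_mul η).mono' ?_ (Eventually.of_forall fun z => hpt z)
    exact ((hg.1.aestronglyMeasurable.mul hψi.aestronglyMeasurable).sub
      (hψi.aestronglyMeasurable.const_mul _))
  have hgψ : Integrable fun z => g z * ψ z := by
    have := hdiffi.add (hψi.const_mul (g x))
    refine this.congr (Eventually.of_forall fun z => ?_)
    simp
  have hmain : |(∫ z, g z * ψ z) - g x * ∫ z, ψ z| ≤ η * (h n ^ w * I) := by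
    rw [← integral_const_mul, ← integral_sub hgψ (hψi.const_mul _)]
    refine (abs_integral_le (hψi.abs.const_mul η) hpt).trans ?_
    rw [integral_const_mul]
    exact (congrArg (η * ·) (hchange (h n) h0 fun u => |φ u|)).le
  have hψm : Measurable ψ := (hφ.comp (by fun_prop)).measurable
  have e1 : ∫ ω, φ ((h n)⁻¹ • (X 0 ω - x)) ∂μ = ∫ z, g z * ψ z := hg.integral_comp hX hψm
  rw [e1, Real.dist_eq]
  have hw0 : 0 < h n ^ w := by positivity
  rw [hchange (h n) h0 φ] at hmain
  have e2 : (h n ^ w)⁻¹ * (∫ z, g z * ψ z) - g x * ∫ u, φ u =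
      (h n ^ w)⁻¹ * ((∫ z, g z * ψ z) - g x * (h n ^ w * ∫ u, φ u)) := by
    field_simp
  rw [e2, abs_mul, abs_of_pos (inv_pos.mpr hw0)]
  calc (h n ^ w)⁻¹ * _ ≤ (h n ^ w)⁻¹ * (η * (h n ^ w * I)) := by gcongr
    _ = η * I := by field_simp
    _ < ε := by
      rw [hη, div_mul_eq_mul_div, div_lt_iff₀ (by positivity)]
      nlinarith

/-- Sums over a shrinking neighbourhood of `x` of a stationary mixing process have a variance of
order `n hʷ`, uniformly over the summands with a given bound. -/
theorem exists_variance_le (hX : ∀ i, Measurable (X i)) (hY : ∀ i, Measurable (Y i)) (hδ : 0 < δ)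
    (hmix : MixingAssumption μ (fun i ω => (X i ω, Y i ω)) δ)
    (hg : HasDensity μ (X 0) g) (hG : ∀ i, 1 ≤ i → HasDensity μ (fun ω => (X 0 ω, X i ω)) (G i))
    (hgx : ContinuousAt g x)
    (hbound : ∃ M : ℝ, 0 < M ∧ ∀ i : ℕ, 1 ≤ i → ∀ u v : E w, |G i (u, v) - g u * g v| ≤ M)
    (hh : BandwidthAssumption w δ h) {R : ℝ} (hR : 0 ≤ R) (C : ℝ) :
    ∃ A : ℝ, 0 ≤ A ∧ ∀ᶠ n in atTop, ∀ f : E w × ℝ → ℝ, Measurable f → (∀ z, |f z| ≤ C) →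
      (∀ z, R * h n < ‖z.1 - x‖ → f z = 0) →
      Var[fun ω => ∑ i ∈ Finset.range n, f (X i ω, Y i ω); μ] ≤ A * (n * h n ^ w) := by
  obtain ⟨M, hM, hGM⟩ := hbound
  obtain ⟨B, hB0, hB⟩ := exists_alphaMixing_le hδ hmix.rate
  set c := |g x| + 1 with hc
  have hc0 : 0 < c := by positivity
  set b := R ^ w * volume.real (Metric.ball (0 : E w) 1) with hb
  have hb0 : 0 ≤ b := by positivity
  obtain ⟨ρ, hρ, hball⟩ := Metric.continuousAt_iff.mp hgx 1 one_pos
  -- One constant for both densities: with `b h^w` the volume of the ball, the marginal probability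
  -- is at most `c b h^w` and the joint one at most `(c² + M) b² h^{2w}`.
  set A := c * b + (c ^ 2 + M) * b ^ 2 with hA
  have hA0 : 0 ≤ A := by positivity
  refine ⟨6 * C ^ 2 * (A + A ^ 2) + 16 * C ^ 2 * B, by positivity, ?_⟩
  filter_upwards [hh.eventually_mul_lt R hρ,
    hh.tendsto_zero.eventually (gt_mem_nhds zero_lt_one)] with n hn hn1 f hf hfC hfs
  have h0 := hh.pos n
  set D := Metric.closedBall x (R * h n) with hD
  have hDm : MeasurableSet D := Metric.isClosed_closedBall.measurableSet
  have hgD : ∀ z ∈ D, g z ≤ c := by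
    intro z hz
    have h1 := hball (x := z) (lt_of_le_of_lt hz hn)
    rw [Real.dist_eq] at h1
    have h2 := (abs_lt.mp h1).2
    linarith [le_abs_self (g x)]
  have hvol : volume.real D = b * h n ^ w := by
    rw [hD, volume_real_closedBall x (by positivity), mul_pow, hb]; ring
  have hvolD : volume D ≠ ⊤ := measure_closedBall_lt_top.ne
  refine variance_sum_le (V := fun i ω => (X i ω, Y i ω)) hmix.stationary
    (fun i => (hX i).prodMk (hY i)) hB0.le hB hf hfC
    (D := D ×ˢ Set.univ) (hDm.prod MeasurableSet.univ) ?_ (A := A) hA0 (by positivity)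
    (pow_le_one₀ h0.le hn1.le) ?_ ?_ n
  · intro z hz
    refine hfs z (not_le.mp fun hle => hz ⟨?_, trivial⟩)
    rwa [hD, mem_closedBall_iff_norm]
  · have h1 := hg.measureReal_preimage_le (hX 0) hDm hvolD hc0.le hgD
    have h2 : (fun ω => (X 0 ω, Y 0 ω)) ⁻¹' (D ×ˢ Set.univ) = X 0 ⁻¹' D := by ext ω; simp
    rw [h2]
    refine h1.trans ?_
    rw [hvol, ← mul_assoc]
    refine mul_le_mul_of_nonneg_right ?_ (by positivity)
    have : 0 ≤ (c ^ 2 + M) * b ^ 2 := by positivity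
    linarith
  · intro l hl
    have h1 := (hG l hl).measureReal_preimage_le ((hX 0).prodMk (hX l)) (hDm.prod hDm)
      (by rw [Measure.volume_eq_prod, Measure.prod_prod]; exact ENNReal.mul_ne_top hvolD hvolD)
      (c := c ^ 2 + M) (by positivity) (by
        rintro ⟨u, v⟩ ⟨hu, hv⟩
        have h3 := (abs_le.mp (hGM l hl u v)).2
        have h4 : g u * g v ≤ c ^ 2 := by
          rw [sq]; exact mul_le_mul (hgD u hu) (hgD v hv) (hg.2.1 v) hc0.le
        linarith)
    have h2 : (fun ω => (X 0 ω, Y 0 ω)) ⁻¹' (D ×ˢ Set.univ) ∩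
        (fun ω => (X l ω, Y l ω)) ⁻¹' (D ×ˢ Set.univ) =
        (fun ω => (X 0 ω, X l ω)) ⁻¹' (D ×ˢ D) := by ext ω; simp
    rw [h2]
    refine h1.trans ?_
    rw [Measure.volume_eq_prod, measureReal_prod_prod, hvol]
    have h3 : 0 ≤ c * b * (h n ^ w) ^ 2 := by positivity
    rw [hA]
    nlinarith

end Limits

/-! ### Stochastic orders and laws of large numbers. -/

section Limits

variable {Ω : Type*} [MeasurableSpace Ω] {μ : Measure Ω} [IsProbabilityMeasure μ] {w : ℕ}
  {X : ℕ → Ω → E w} {Y : ℕ → Ω → ℝ} {δ : ℝ} {g : E w → ℝ} {G : ℕ → E w × E w → ℝ} {x : E w}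
  {h : ℕ → ℝ}

/-- Chebyshev's inequality with the uniform variance bound. The summand may vary with `n`, and its
properties are required only eventually, because it will carry a population tilt that depends on `n`
and exists only for large `n`. -/
theorem isBigOInProb_sum (hX : ∀ i, Measurable (X i)) (hY : ∀ i, Measurable (Y i)) (hδ : 0 < δ)
    (hmix : MixingAssumption μ (fun i ω => (X i ω, Y i ω)) δ)
    (hg : HasDensity μ (X 0) g) (hG : ∀ i, 1 ≤ i → HasDensity μ (fun ω => (X 0 ω, X i ω)) (G i))
    (hgx : ContinuousAt g x)
    (hbound : ∃ M : ℝ, 0 < M ∧ ∀ i : ℕ, 1 ≤ i → ∀ u v : E w, |G i (u, v) - g u * g v| ≤ M)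
    (hh : BandwidthAssumption w δ h) {R : ℝ} (hR : 0 ≤ R) {C : ℝ} {f : ℕ → E w × ℝ → ℝ}
    (hf : ∀ᶠ n in atTop, Measurable (f n) ∧ (∀ z, |f n z| ≤ C) ∧
      ∀ z, R * h n < ‖z.1 - x‖ → f n z = 0) :
    IsBigOInProb μ (fun n ω => ((n : ℝ) * h n ^ w)⁻¹ *
        (∑ i ∈ Finset.range n, f n (X i ω, Y i ω) - n * ∫ ω, f n (X 0 ω, Y 0 ω) ∂μ))
      (fun n => ((n : ℝ) * h n ^ w) ^ (-(1 / 2) : ℝ)) := by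
  obtain ⟨A, hA, hvar⟩ := exists_variance_le hX hY hδ hmix hg hG hgx hbound hh hR C
  intro ε hε
  -- Chebyshev gives the bound `A / M²`, which is at most `ε` since `A ≤ ε M` and `M ≥ 1`.
  refine ⟨A / ε + 1, by positivity, ?_⟩
  filter_upwards [hvar, hf, (hh.tendsto_mul_pow hδ).eventually_gt_atTop 0] with n hn hfn hN
  obtain ⟨hfm, hfC, hfs⟩ := hfn
  have hv := hn (f n) hfm hfC hfs
  set N := (n : ℝ) * h n ^ w with hNdef
  set M := A / ε + 1 with hM
  have hM0 : 0 < M := by positivity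
  have hV : ∀ i, Measurable fun ω => (X i ω, Y i ω) := fun i => (hX i).prodMk (hY i)
  have hmem : MemLp (fun ω => ∑ i ∈ Finset.range n, f n (X i ω, Y i ω)) 2 μ := by
    refine memLp_finsetSum _ fun i _ => MemLp.of_bound
      (hfm.comp (hV i)).aestronglyMeasurable C (Eventually.of_forall fun ω => hfC _)
  have hmean : ∫ ω, ∑ i ∈ Finset.range n, f n (X i ω, Y i ω) ∂μ =
      n * ∫ ω, f n (X 0 ω, Y 0 ω) ∂μ := by
    rw [integral_finsetSum]
    · simp_rw [hmix.stationary.integral_eq hV hfm]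
      simp
    · exact fun i _ => Integrable.of_bound (hfm.comp (hV i)).aestronglyMeasurable C
        (Eventually.of_forall fun ω => hfC _)
  have hsq : N ^ (-(1 / 2) : ℝ) = (Real.sqrt N)⁻¹ := by
    rw [Real.rpow_neg hN.le, ← Real.sqrt_eq_rpow]
  have hs0 : 0 < Real.sqrt N := Real.sqrt_pos.mpr hN
  have hss : Real.sqrt N ^ 2 = N := Real.sq_sqrt hN.le
  have hc : 0 < M * Real.sqrt N := by positivity
  refine (measure_mono ?_).trans ((meas_ge_le_variance_div_sq hmem hc).trans
    (ENNReal.ofReal_le_ofReal ?_))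
  · intro ω hω
    simp only [Set.mem_ofPred_eq] at hω ⊢
    rw [hmean]
    rw [hsq, abs_mul, abs_of_pos (inv_pos.mpr hN), ← div_eq_mul_inv, ← div_eq_inv_mul,
      div_lt_div_iff₀ hs0 hN] at hω
    have : M * Real.sqrt N * Real.sqrt N = M * N := by rw [mul_assoc, ← sq, hss]
    nlinarith
  · rw [div_le_iff₀ (by positivity), mul_pow, hss]
    refine hv.trans ?_
    rw [← mul_assoc ε]
    refine mul_le_mul_of_nonneg_right ?_ hN.le
    have h1 : A ≤ ε * M := by
      rw [hM, mul_add, mul_div_cancel₀ _ hε.ne']; linarith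
    have h2 : M ≤ M ^ 2 := by
      have : 1 ≤ M := by rw [hM]; linarith [div_nonneg hA hε.le]
      nlinarith
    nlinarith

omit [IsProbabilityMeasure μ] in
theorem IsBigOInProb.tendsto_zero {Rn : ℕ → Ω → ℝ} {a : ℕ → ℝ} (hR : IsBigOInProb μ Rn a)
    (ha : Tendsto a atTop (𝓝 0)) {ε : ℝ} (hε : 0 < ε) :
    Tendsto (fun n => μ {ω | ε < |Rn n ω|}) atTop (𝓝 0) := by
  rw [ENNReal.tendsto_nhds_zero]
  intro η hη
  obtain ⟨t, ht, htη⟩ : ∃ t : ℝ, 0 < t ∧ ENNReal.ofReal t ≤ η := by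
    rcases eq_or_ne η ⊤ with rfl | hne
    · exact ⟨1, one_pos, le_top⟩
    · exact ⟨η.toReal, ENNReal.toReal_pos hη.ne' hne, (ENNReal.ofReal_toReal hne).le⟩
  obtain ⟨M, hM, hev⟩ := hR t ht
  have h1 : ∀ᶠ n in atTop, M * a n < ε := by
    have := ha.const_mul M
    rw [mul_zero] at this
    exact this.eventually (gt_mem_nhds hε)
  filter_upwards [hev, h1] with n hn hn1
  refine (measure_mono fun ω hω => ?_).trans (hn.trans htη)
  exact hn1.trans hω

theorem BandwidthAssumption.tendsto_rate (hh : BandwidthAssumption w δ h) (hδ : 0 < δ) :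
    Tendsto (fun n : ℕ => ((n : ℝ) * h n ^ w) ^ (-(1 / 2) : ℝ)) atTop (𝓝 0) :=
  (tendsto_rpow_neg_atTop (by norm_num)).comp (hh.tendsto_mul_pow hδ)

/-- The law of large numbers for kernel averages. -/
theorem tendsto_kernel_average (hX : ∀ i, Measurable (X i)) (hY : ∀ i, Measurable (Y i))
    (hδ : 0 < δ) (hmix : MixingAssumption μ (fun i ω => (X i ω, Y i ω)) δ)
    (hg : HasDensity μ (X 0) g) (hG : ∀ i, 1 ≤ i → HasDensity μ (fun ω => (X 0 ω, X i ω)) (G i))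
    (hgx : ContinuousAt g x)
    (hbound : ∃ M : ℝ, 0 < M ∧ ∀ i : ℕ, 1 ≤ i → ∀ u v : E w, |G i (u, v) - g u * g v| ≤ M)
    (hh : BandwidthAssumption w δ h) {φ : E w → ℝ} (hφ : Continuous φ)
    (hφs : HasCompactSupport φ) {ε : ℝ} (hε : 0 < ε) :
    Tendsto (fun n : ℕ => μ {ω | ε < |((n : ℝ) * h n ^ w)⁻¹ *
      ∑ i ∈ Finset.range n, φ ((h n)⁻¹ • (X i ω - x)) - g x * ∫ u, φ u|}) atTop (𝓝 0) := by
  obtain ⟨R, hR0, hR⟩ : ∃ R, 0 ≤ R ∧ ∀ u, R < ‖u‖ → φ u = 0 := by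
    obtain ⟨R, hR⟩ := hφs.isCompact.isBounded.exists_norm_le
    exact ⟨|R|, abs_nonneg R, fun u hu => image_eq_zero_of_notMem_tsupport fun hmem =>
      absurd (hR u hmem) (not_le.mpr ((le_abs_self R).trans_lt hu))⟩
  obtain ⟨C, hC⟩ := hφs.exists_bound_of_continuous hφ
  have hO := isBigOInProb_sum hX hY hδ hmix hg hG hgx hbound hh hR0 (C := C)
    (f := fun n z => φ ((h n)⁻¹ • (z.1 - x))) (Eventually.of_forall fun n => ⟨?_, fun z => hC _,
      fun z hz => hR _ ?_⟩)
  · have ht := hO.tendsto_zero (hh.tendsto_rate hδ) (half_pos hε)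
    have hm := Metric.tendsto_nhds.mp (tendsto_mean (hX 0) hg hgx hh hφ hφs) (ε / 2) (half_pos hε)
    refine tendsto_of_tendsto_of_tendsto_of_le_of_le' tendsto_const_nhds ht
      (Eventually.of_forall fun n => bot_le) ?_
    filter_upwards [hm, eventually_gt_atTop 0] with n hn hn0
    refine measure_mono fun ω hω => ?_
    simp only [Set.mem_ofPred_eq] at hω ⊢
    rw [Real.dist_eq] at hn
    have hn' : (n : ℝ) ≠ 0 := by exact_mod_cast hn0.ne'
    have hh' : h n ^ w ≠ 0 := (pow_pos (hh.pos n) w).ne'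
    set m := ∫ ω, φ ((h n)⁻¹ • (X 0 ω - x)) ∂μ
    set S := ∑ i ∈ Finset.range n, φ ((h n)⁻¹ • (X i ω - x))
    -- Fluctuation around the mean plus the error of the mean, each allowed `ε / 2`.
    have e : ((n : ℝ) * h n ^ w)⁻¹ * S - g x * ∫ u, φ u =
        ((n : ℝ) * h n ^ w)⁻¹ * (S - n * m) + ((h n ^ w)⁻¹ * m - g x * ∫ u, φ u) := by
      field_simp; ring
    rw [e] at hω
    have := abs_add_le (((n : ℝ) * h n ^ w)⁻¹ * (S - n * m)) ((h n ^ w)⁻¹ * m - g x * ∫ u, φ u)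
    linarith
  · exact (hφ.measurable).comp (by fun_prop)
  · have h0 := hh.pos n
    rw [norm_smul, norm_inv, Real.norm_of_nonneg h0.le, ← div_eq_inv_mul, lt_div_iff₀ h0]
    exact hz

/-- The deviation from the conditional distribution function is centred given the predictor. -/
theorem integral_mul_indicator_sub_condCDF {κ : Kernel (E w) ℝ} [IsMarkovKernel κ]
    (hκ : HasCondDistrib (Y 0) (X 0) κ μ) (hX : Measurable (X 0)) (hY : Measurable (Y 0)) (y : ℝ)
    {ψ : E w → ℝ} (hψ : Measurable ψ) {C : ℝ} (hC : ∀ z, |ψ z| ≤ C) :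
    ∫ ω, ψ (X 0 ω) * (Set.indicator (Set.Iic y) (fun _ => (1 : ℝ)) (Y 0 ω) -
      condCDF κ y (X 0 ω)) ∂μ = 0 := by
  have hFm : Measurable (condCDF κ y) :=
    (Kernel.measurable_coe κ measurableSet_Iic).ennreal_toReal
  set Ψ : E w × ℝ → ℝ := fun z => ψ z.1 * (Set.indicator (Set.Iic y) (fun _ => (1 : ℝ)) z.2 -
      condCDF κ y z.1) with hΨ
  have hind : Measurable (Set.indicator (Set.Iic y) (fun _ => (1 : ℝ))) :=
    measurable_const.indicator measurableSet_Iic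
  have hΨm : Measurable Ψ := (hψ.comp measurable_fst).mul
    ((hind.comp measurable_snd).sub (hFm.comp measurable_fst))
  have hF : ∀ z, |condCDF κ y z| ≤ 1 := fun z => by
    rw [condCDF, abs_of_nonneg measureReal_nonneg]; exact measureReal_le_one
  have hI : ∀ b, |Set.indicator (Set.Iic y) (fun _ => (1 : ℝ)) b| ≤ 1 := fun b => by
    by_cases hb : b ∈ Set.Iic y <;> simp [hb]
  have : ∫ ω, Ψ (X 0 ω, Y 0 ω) ∂μ = 0 := by
    rw [← integral_map (hX.prodMk hY).aemeasurable hΨm.aestronglyMeasurable, hκ.map_eq]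
    have : IsProbabilityMeasure (μ.map (X 0)) := Measure.isProbabilityMeasure_map hX.aemeasurable
    -- Disintegration: given `X 0 = a`, the indicator has conditional mean `condCDF κ y a`, so the
    -- inner integral vanishes.
    rw [Measure.integral_compProd]
    · refine integral_eq_zero_of_ae (Eventually.of_forall fun a => ?_)
      simp only [hΨ, Pi.zero_apply]
      rw [integral_const_mul, integral_sub
        ((integrable_const 1).indicator measurableSet_Iic) (integrable_const _),
        integral_indicator_const _ measurableSet_Iic]
      simp [condCDF]
    · refine Integrable.of_bound hΨm.aestronglyMeasurable (C * 2)
        (Eventually.of_forall fun z => ?_)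
      simp only [hΨ, Real.norm_eq_abs, abs_mul]
      have h1 := abs_sub (Set.indicator (Set.Iic y) (fun _ => (1 : ℝ)) z.2) (condCDF κ y z.1)
      have h2 := (abs_nonneg _).trans (hC z.1)
      refine mul_le_mul (hC _) ?_ (abs_nonneg _) h2
      linarith [hF z.1, hI z.2]
  exact this

end Limits

/-! ### Second order Taylor expansion. -/

section Taylor

variable {w : ℕ}

theorem hessian_sum_eq {f : E w → ℝ} {x : E w} (hf : ContDiffAt ℝ 2 f x) (v : E w) :
    fderiv ℝ (fderiv ℝ f) x v v = ∑ j, ∑ k, v j * v k * hessian f x j k := by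
  have hd : DifferentiableAt ℝ (fderiv ℝ f) x :=
    (hf.fderiv_right (m := 1) (by norm_num)).differentiableAt (by norm_num)
  have hh : ∀ j k, hessian f x j k = fderiv ℝ (fderiv ℝ f) x (EuclideanSpace.single j 1)
      (EuclideanSpace.single k 1) := by
    intro j k
    rw [hessian, Matrix.of_apply, fderiv_clm_apply hd (differentiableAt_const _)]
    simp
  have hv : v = ∑ j, v j • EuclideanSpace.single j (1 : ℝ) := by
    ext i
    simp [Finset.sum_apply, Pi.single_apply]
  conv_lhs => rw [hv]
  simp only [map_sum, map_smul, _root_.sum_apply, _root_.smul_apply,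
    smul_eq_mul, hh, Finset.mul_sum, mul_assoc]
  rw [Finset.sum_comm]
  exact Finset.sum_congr rfl fun j _ => Finset.sum_congr rfl fun k _ => by ring

/-- Second order Taylor expansion with the Peano remainder. -/
theorem exists_taylor_two {f : E w → ℝ} {x : E w} (hf : ContDiffAt ℝ 2 f x) {η : ℝ} (hη : 0 < η) :
    ∃ ρ > 0, ∀ v : E w, ‖v‖ < ρ →
      |f (x + v) - f x - fderiv ℝ f x v - 1 / 2 * fderiv ℝ (fderiv ℝ f) x v v| ≤ η * ‖v‖ ^ 2 := by
  have hd : DifferentiableAt ℝ (fderiv ℝ f) x :=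
    (hf.fderiv_right (m := 1) (by norm_num)).differentiableAt (by norm_num)
  have h1 := hd.hasFDerivAt.isLittleO.def hη
  have h2 : ∀ᶠ z in 𝓝 x, DifferentiableAt ℝ f z := by
    filter_upwards [hf.eventually (by simp)] with z hz
    exact hz.differentiableAt (by norm_num)
  obtain ⟨ρ, hρ, hball⟩ := Metric.eventually_nhds_iff.mp (h1.and h2)
  refine ⟨ρ, hρ, fun v hv => ?_⟩
  set D := fderiv ℝ (fderiv ℝ f) x with hD
  -- The function along the segment minus its quadratic polynomial. Its derivative is the first
  -- order remainder of `fderiv ℝ f` at `x` applied to `v`, so the mean value inequality on `[0, 1]`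
  -- concludes.
  set φ : ℝ → ℝ := fun t => f (x + t • v) - t * fderiv ℝ f x v - t ^ 2 / 2 * D v v with hφ
  have hmem : ∀ t ∈ Set.Icc (0 : ℝ) 1, ‖t • v‖ ≤ ‖v‖ := fun t ht => by
    rw [norm_smul, Real.norm_of_nonneg ht.1]
    exact mul_le_of_le_one_left (norm_nonneg v) ht.2
  have hder : ∀ t ∈ Set.Icc (0 : ℝ) 1, HasDerivAt φ
      (fderiv ℝ f (x + t • v) v - fderiv ℝ f x v - t * D v v) t := by
    intro t ht
    have hz := (hball (y := x + t • v) (by simpa using (hmem t ht).trans_lt hv)).2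
    have e1 : HasDerivAt (fun t : ℝ => x + t • v) v t := by
      simpa using ((hasDerivAt_id t).smul_const v).const_add x
    have e2 := hz.hasFDerivAt.comp_hasDerivAt t e1
    have e3 : HasDerivAt (fun t : ℝ => t * fderiv ℝ f x v) (fderiv ℝ f x v) t := by
      simpa using (hasDerivAt_id t).mul_const (fderiv ℝ f x v)
    have e4 : HasDerivAt (fun t : ℝ => t ^ 2 / 2 * D v v) (t * D v v) t := by
      have := (((hasDerivAt_id t).pow 2).div_const 2).mul_const (D v v)
      simpa using this
    exact (e2.sub e3).sub e4
  have hbd : ∀ t ∈ Set.Icc (0 : ℝ) 1,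
      ‖fderiv ℝ f (x + t • v) v - fderiv ℝ f x v - t * D v v‖ ≤ η * ‖v‖ ^ 2 := by
    intro t ht
    have hz := (hball (y := x + t • v) (by simpa using (hmem t ht).trans_lt hv)).1
    rw [add_sub_cancel_left] at hz
    have e : fderiv ℝ f (x + t • v) v - fderiv ℝ f x v - t * D v v =
        (fderiv ℝ f (x + t • v) - fderiv ℝ f x - D (t • v)) v := by simp
    rw [e]
    calc _ ≤ ‖fderiv ℝ f (x + t • v) - fderiv ℝ f x - D (t • v)‖ * ‖v‖ :=
          ContinuousLinearMap.le_opNorm _ _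
      _ ≤ η * ‖t • v‖ * ‖v‖ := by gcongr
      _ ≤ η * ‖v‖ * ‖v‖ := by have := hmem t ht; gcongr
      _ = _ := by ring
  have := norm_image_sub_le_of_norm_deriv_le_segment_01'
    (fun t ht => (hder t ht).hasDerivWithinAt) fun t ht => hbd t ⟨ht.1, ht.2.le⟩
  simp only [hφ, one_smul, zero_smul, Real.norm_eq_abs] at this
  convert this using 2
  simp; ring

end Taylor

/-! ### Events of probability tending to one. -/

section Likely

variable {Ω : Type*} [MeasurableSpace Ω] {μ : Measure Ω}

/-- The probability of `P n` tends to one. -/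
def Likely (μ : Measure Ω) (P : ℕ → Ω → Prop) : Prop :=
  Tendsto (fun n => μ {ω | ¬ P n ω}) atTop (𝓝 0)

theorem Likely.mono {P Q : ℕ → Ω → Prop} (hP : Likely μ P)
    (hPQ : ∀ᶠ n in atTop, ∀ ω, P n ω → Q n ω) : Likely μ Q := by
  refine tendsto_of_tendsto_of_tendsto_of_le_of_le' tendsto_const_nhds hP
    (Eventually.of_forall fun n => bot_le) ?_
  filter_upwards [hPQ] with n hn
  exact measure_mono fun ω hω hPω => hω (hn ω hPω)

theorem Likely.and {P Q : ℕ → Ω → Prop} (hP : Likely μ P) (hQ : Likely μ Q) :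
    Likely μ fun n ω => P n ω ∧ Q n ω := by
  have h := hP.add hQ
  rw [add_zero] at h
  refine tendsto_of_tendsto_of_tendsto_of_le_of_le tendsto_const_nhds h (fun n => bot_le)
    fun n => (measure_mono fun ω hω => ?_).trans (measure_union_le _ _)
  by_cases hPω : P n ω
  · exact Or.inr fun hQω => hω ⟨hPω, hQω⟩
  · exact Or.inl hPω

theorem Likely.forall {ι : Type*} [Fintype ι] {P : ι → ℕ → Ω → Prop} (hP : ∀ i, Likely μ (P i)) :
    Likely μ fun n ω => ∀ i, P i n ω := by
  have h := tendsto_finsetSum Finset.univ fun i _ => hP i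
  rw [Finset.sum_const_zero] at h
  refine tendsto_of_tendsto_of_tendsto_of_le_of_le tendsto_const_nhds h (fun n => bot_le)
    fun n => (measure_mono fun ω hω => ?_).trans (measure_iUnion_fintype_le μ _)
  obtain ⟨i, hi⟩ := not_forall.mp hω
  exact Set.mem_iUnion.mpr ⟨i, hi⟩

/-- Transfers the order from finitely many linear statistics to a nonlinear one which they dominate
on likely events. -/
theorem IsBigOInProb.of_likely_le {ι : Type*} [Fintype ι] {Q : ι → ℕ → Ω → ℝ} {Rn : ℕ → Ω → ℝ}
    {a : ℕ → ℝ} (ha : ∀ n, 0 ≤ a n) (hQ : ∀ i, IsBigOInProb μ (Q i) a) {c : ℝ} (hc : 0 ≤ c)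
    (h : Likely μ fun n ω => |Rn n ω| ≤ c * ∑ i, |Q i n ω|) : IsBigOInProb μ Rn a := by
  intro ε hε
  -- There are `card ι + 1` exceptional events: one for each statistic and one for the failure of
  -- the domination.
  set η : ℝ := ε / (Fintype.card ι + 1) with hη
  have hη0 : 0 < η := by positivity
  choose M hM hev using fun i => hQ i η hη0
  refine ⟨c * ∑ i, M i + 1,
    add_pos_of_nonneg_of_pos (mul_nonneg hc (Finset.sum_nonneg fun i _ => (hM i).le)) one_pos, ?_⟩
  have h1 := (ENNReal.tendsto_nhds_zero.mp h) (ENNReal.ofReal η) (ENNReal.ofReal_pos.mpr hη0)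
  filter_upwards [h1, eventually_all.mpr hev] with n hn hn'
  calc μ {ω | (c * ∑ i, M i + 1) * a n < |Rn n ω|}
      ≤ μ ({ω | ¬ |Rn n ω| ≤ c * ∑ i, |Q i n ω|} ∪ ⋃ i, {ω | M i * a n < |Q i n ω|}) := by
        refine measure_mono fun ω hω => ?_
        by_contra hcon
        simp only [Set.mem_union, Set.mem_iUnion, Set.mem_ofPred_eq, not_or, not_exists, not_lt,
          not_not] at hcon hω
        have h3 : ∑ i, |Q i n ω| ≤ (∑ i, M i) * a n := by
          rw [Finset.sum_mul]
          exact Finset.sum_le_sum fun i _ => hcon.2 i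
        have h4 := mul_le_mul_of_nonneg_left h3 hc
        nlinarith [hcon.1, ha n]
    _ ≤ ENNReal.ofReal η + ∑ _i : ι, ENNReal.ofReal η :=
        (measure_union_le _ _).trans (add_le_add hn ((measure_iUnion_fintype_le μ _).trans
          (Finset.sum_le_sum fun i _ => hn' i)))
    _ = ENNReal.ofReal ε := by
        rw [← ENNReal.ofReal_sum_of_nonneg fun _ _ => hη0.le, ← ENNReal.ofReal_add hη0.le
          (Finset.sum_nonneg fun _ _ => hη0.le)]
        congr 1
        simp only [Finset.sum_const, Finset.card_univ, nsmul_eq_mul]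
        rw [hη]; field_simp; ring

end Likely

/-! ### Solvability of the first order condition in coordinates. -/

section Coordinates

variable {A : Type*} [MeasurableSpace A] {w : ℕ}

theorem inner_eq_sum (l z : E w) : ⟪l, z⟫ = ∑ j, l j * z j := by
  rw [PiLp.inner_apply]
  exact Finset.sum_congr rfl fun j _ => by simp [mul_comm]

theorem abs_coord_le (l : E w) (j : Fin w) : |l j| ≤ ‖l‖ := PiLp.norm_apply_le l j

theorem norm_sq_eq_sum (l : E w) : ‖l‖ ^ 2 = ∑ j, l j ^ 2 := by
  rw [EuclideanSpace.norm_sq_eq]; simp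

/-- Solvability of the first order condition from approximations to the coordinates of the first two
moments. -/
theorem exists_tilt_of_moments (ν : Measure A) [IsFiniteMeasure ν] {W : A → E w}
    (hW : Measurable W) {C r c s N : ℝ} (hC : ∀ a, ‖W a‖ ≤ C) (hr : 0 < r) (hrC : r * C ≤ 1 / 8)
    (hw : 1 ≤ w) (hN : 0 < N)
    (h1 : ∀ j, |N⁻¹ * ∫ a, W a j ∂ν| ≤ s)
    (h2 : ∀ j k, |N⁻¹ * ∫ a, W a j * W a k ∂ν - c * (1 : Matrix (Fin w) (Fin w) ℝ) j k| ≤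
      c / (2 * w ^ 2)) (hs : w * s < c * r / 8) :
    (∀ l : E w, c / 2 * N * ‖l‖ ^ 2 ≤ ∫ a, ⟪l, W a⟫ ^ 2 ∂ν) ∧
    ∃ l : E w, ‖l‖ < r ∧ ∀ e : E w, ∫ a, ⟪e, W a⟫ / (1 + ⟪l, W a⟫) ∂ν = 0 := by
  have hWm : ∀ j, Measurable fun a => W a j := fun j => by fun_prop
  have hi1 : ∀ j, Integrable (fun a => W a j) ν := fun j =>
    Integrable.of_bound (hWm j).aestronglyMeasurable C
      (Eventually.of_forall fun a => (abs_coord_le _ j).trans (hC a))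
  have hi2 : ∀ j k, Integrable (fun a => W a j * W a k) ν := fun j k =>
    (hi1 k).bdd_mul (hWm j).aestronglyMeasurable
      (Eventually.of_forall fun a => (abs_coord_le _ j).trans (hC a))
  have hw' : (0 : ℝ) < w := by exact_mod_cast hw
  -- The second moment matrix is close to `c I`: `w²` entrywise errors of size `c / (2 w²)` cost at
  -- most half of `c ‖l‖²`.
  have hquad : ∀ l : E w, c / 2 * N * ‖l‖ ^ 2 ≤ ∫ a, ⟪l, W a⟫ ^ 2 ∂ν := by
    intro l
    have e1 : ∫ a, ⟪l, W a⟫ ^ 2 ∂ν = ∑ j, ∑ k, l j * l k * ∫ a, W a j * W a k ∂ν := by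
      have e : ∀ a, ⟪l, W a⟫ ^ 2 = ∑ j, ∑ k, l j * l k * (W a j * W a k) := by
        intro a
        rw [inner_eq_sum, sq, Finset.sum_mul_sum]
        exact Finset.sum_congr rfl fun j _ => Finset.sum_congr rfl fun k _ => by ring
      simp only [e]
      rw [integral_finsetSum _ fun j _ => integrable_finsetSum _ fun k _ => (hi2 j k).const_mul _]
      refine Finset.sum_congr rfl fun j _ => ?_
      rw [integral_finsetSum _ fun k _ => (hi2 j k).const_mul _]
      exact Finset.sum_congr rfl fun k _ => integral_const_mul _ _
    have e2 : c * ‖l‖ ^ 2 = ∑ j, ∑ k, l j * l k * (c * (1 : Matrix (Fin w) (Fin w) ℝ) j k) := by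
      rw [norm_sq_eq_sum, Finset.mul_sum]
      refine Finset.sum_congr rfl fun j _ => ?_
      simp [Matrix.one_apply]; ring
    have e3 : |N⁻¹ * ∫ a, ⟪l, W a⟫ ^ 2 ∂ν - c * ‖l‖ ^ 2| ≤ c / 2 * ‖l‖ ^ 2 := by
      rw [e1, e2, Finset.mul_sum, ← Finset.sum_sub_distrib]
      calc _ ≤ ∑ j : Fin w, ∑ k : Fin w, ‖l‖ * ‖l‖ * (c / (2 * w ^ 2)) := by
            refine (Finset.abs_sum_le_sum_abs _ _).trans (Finset.sum_le_sum fun j _ => ?_)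
            rw [Finset.mul_sum, ← Finset.sum_sub_distrib]
            refine (Finset.abs_sum_le_sum_abs _ _).trans (Finset.sum_le_sum fun k _ => ?_)
            have : N⁻¹ * (l j * l k * ∫ a, W a j * W a k ∂ν) -
                l j * l k * (c * (1 : Matrix (Fin w) (Fin w) ℝ) j k) = l j * l k *
                (N⁻¹ * ∫ a, W a j * W a k ∂ν - c * (1 : Matrix (Fin w) (Fin w) ℝ) j k) := by ring
            rw [this, abs_mul, abs_mul]
            have := abs_coord_le l j
            have := abs_coord_le l k
            have := h2 j k
            gcongr
        _ = c / 2 * ‖l‖ ^ 2 := by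
            simp only [Finset.sum_const, Finset.card_univ, Fintype.card_fin, nsmul_eq_mul]
            field_simp
    have e4 := (abs_le.mp e3).1
    have e5 : c / 2 * ‖l‖ ^ 2 ≤ N⁻¹ * ∫ a, ⟪l, W a⟫ ^ 2 ∂ν := by linarith
    rw [← div_eq_inv_mul, le_div_iff₀ hN] at e5
    linarith
  -- Rescaling by `N` turns the hypothesis `w s < c r / 8` into the condition `s < v r / 4` of
  -- `exists_tilt`.
  refine ⟨hquad, exists_tilt ν hW hC hr hrC (s := N * (w * s)) (v := c / 2 * N) ?_ ?_ hquad⟩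
  · intro l
    have e1 : ∫ a, ⟪l, W a⟫ ∂ν = ∑ j, l j * ∫ a, W a j ∂ν := by
      simp only [inner_eq_sum]
      rw [integral_finsetSum _ fun j _ => (hi1 j).const_mul _]
      exact Finset.sum_congr rfl fun j _ => integral_const_mul _ _
    rw [e1]
    calc _ ≤ ∑ _j : Fin w, ‖l‖ * (N * s) := by
          refine Finset.sum_le_sum fun j _ => (le_abs_self _).trans ?_
          rw [abs_mul]
          have e2 := abs_coord_le l j
          have e3 := h1 j
          rw [abs_mul, abs_of_pos (inv_pos.mpr hN), ← div_eq_inv_mul, div_le_iff₀ hN] at e3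
          gcongr
          linarith
      _ = _ := by
          simp only [Finset.sum_const, Finset.card_univ, Fintype.card_fin, nsmul_eq_mul]
          ring
  · nlinarith

end Coordinates

/-! ### Final weights in terms of the tilt. -/

section FinalWeights

variable {w n : ℕ}

theorem finalWeight_eq (K : E w → ℝ) {h : ℝ} (hh : 0 < h) (x : E w) (xs : Fin n → E w)
    (hn : 0 < n) {p a : Fin n → ℝ} (hp : ∀ i, p i = (n * (1 + a i))⁻¹) (i : Fin n) :
    finalWeight K h x xs p i = K (h⁻¹ • (xs i - x)) / (1 + a i) /
      ∑ j, K (h⁻¹ • (xs j - x)) / (1 + a j) := by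
  have hn' : (n : ℝ) ≠ 0 := by exact_mod_cast hn.ne'
  have hw : h ^ w ≠ 0 := (pow_pos hh w).ne'
  have e : ∀ j, p j * scaledKernel K h (xs j - x) =
      ((n : ℝ) * h ^ w)⁻¹ * (K (h⁻¹ • (xs j - x)) / (1 + a j)) := by
    intro j
    rw [hp, scaledKernel, mul_inv, mul_inv, div_eq_mul_inv]
    ring
  simp only [finalWeight, e]
  rw [← Finset.mul_sum, mul_div_mul_left _ _ (inv_ne_zero (mul_ne_zero hn' hw))]

theorem mul_sum_le_sum_div {k a : Fin n → ℝ} (hk : ∀ i, 0 ≤ k i) (ha : ∀ i, |a i| ≤ 1 / 8) :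
    1 / 2 * ∑ i, k i ≤ ∑ i, k i / (1 + a i) := by
  rw [Finset.mul_sum]
  refine Finset.sum_le_sum fun i _ => ?_
  have := abs_le.mp (ha i)
  rw [le_div_iff₀ (by linarith)]
  nlinarith [hk i]

/-- Lipschitz dependence on the tilt: `1/(1 + a) - 1/(1 + b) = (b - a)/((1 + a)(1 + b))`, with
denominator at least `1/2`. The bound on `e` is asked only where `k` does not vanish, since the
Taylor terms are controlled only on the support of the kernel. -/
theorem abs_sum_div_sub_sum_div_le {k a b e : Fin n → ℝ} (hk : ∀ i, 0 ≤ k i)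
    (ha : ∀ i, |a i| ≤ 1 / 8) (hb : ∀ i, |b i| ≤ 1 / 8) {B t : ℝ} (he : ∀ i, k i ≠ 0 → |e i| ≤ B)
    (ht : ∀ i, |b i - a i| ≤ t) (hB : 0 ≤ B) :
    |∑ i, k i / (1 + a i) * e i - ∑ i, k i / (1 + b i) * e i| ≤ 2 * B * t * ∑ i, k i := by
  rw [← Finset.sum_sub_distrib, Finset.mul_sum]
  refine (Finset.abs_sum_le_sum_abs _ _).trans (Finset.sum_le_sum fun i _ => ?_)
  rcases eq_or_ne (k i) 0 with h0 | h0
  · simp [h0]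
  have ha' := abs_le.mp (ha i)
  have hb' := abs_le.mp (hb i)
  have e1 : k i / (1 + a i) * e i - k i / (1 + b i) * e i =
      k i * e i * (b i - a i) / ((1 + a i) * (1 + b i)) := by
    have : 1 + a i ≠ 0 := by linarith
    have : 1 + b i ≠ 0 := by linarith
    field_simp
    ring
  have hpos : 1 / 2 ≤ (1 + a i) * (1 + b i) := by nlinarith
  rw [e1, abs_div, abs_of_pos (by linarith : 0 < (1 + a i) * (1 + b i)), div_le_iff₀ (by linarith),
    abs_mul, abs_mul, abs_of_nonneg (hk i)]
  have ht0 : 0 ≤ t := (abs_nonneg _).trans (ht i)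
  have h1 : k i * |e i| * |b i - a i| ≤ k i * B * t :=
    mul_le_mul (mul_le_mul_of_nonneg_left (he i h0) (hk i)) (ht i) (abs_nonneg _)
      (mul_nonneg (hk i) hB)
  have h2 : 0 ≤ k i * B * t := by have := hk i; positivity
  nlinarith

end FinalWeights

/-! ### The kernel and its score. -/

section Score

variable {w : ℕ} {K : E w → ℝ} {μ₂ ν₀ ν₂ : ℝ}

/-- The vector `K(u) u` at the rescaled point `u = (z - x) / h`. -/
noncomputable def score (K : E w → ℝ) (h : ℝ) (x z : E w) : E w := K (h⁻¹ • (z - x)) • (h⁻¹ • (z - x))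

theorem KernelAssumption.measurable_score (hK : KernelAssumption K μ₂ ν₀ ν₂) (h : ℝ) (x : E w) :
    Measurable (score K h x) := by
  have := hK.continuous
  unfold score
  exact Continuous.measurable (by fun_prop)

/-- The score is the bounded function `K(u) u` at a rescaled point, so one bound serves all
bandwidths; this lets the radius of the ball of tilts be fixed before `n`. -/
theorem KernelAssumption.exists_norm_le (hK : KernelAssumption K μ₂ ν₀ ν₂) :
    ∃ C, 0 ≤ C ∧ ∀ (h : ℝ) (x z : E w), ‖score K h x z‖ ≤ C := by
  obtain ⟨C, hC⟩ := (hK.compact_support.smul_right (f' := fun u : E w => u)).exists_bound_of_continuous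
    (hK.continuous.smul continuous_id)
  exact ⟨C, (norm_nonneg _).trans (hC 0), fun h x z => hC _⟩

theorem KernelAssumption.exists_radius (hK : KernelAssumption K μ₂ ν₀ ν₂) :
    ∃ R, 0 ≤ R ∧ ∀ u, K u ≠ 0 → ‖u‖ ≤ R := by
  obtain ⟨R, hR⟩ := hK.compact_support.isCompact.isBounded.exists_norm_le
  exact ⟨|R|, abs_nonneg R, fun u hu => (hR u (subset_tsupport _ hu)).trans (le_abs_self R)⟩

theorem KernelAssumption.integral_coord (hK : KernelAssumption K μ₂ ν₀ ν₂) (j : Fin w) :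
    ∫ u : E w, (K u • u) j = 0 := by
  have hi : Integrable fun u : E w => K u • u :=
    (hK.continuous.smul continuous_id).integrable_of_hasCompactSupport
      (hK.compact_support.smul_right (f' := fun u : E w => u))
  have := (EuclideanSpace.proj (𝕜 := ℝ) j).integral_comp_comm hi
  rw [hK.first_moment] at this
  simpa using this

theorem KernelAssumption.integral_coord_mul (hK : KernelAssumption K μ₂ ν₀ ν₂) (j k : Fin w) :
    ∫ u : E w, (K u • u) j * (K u • u) k = ν₂ * (1 : Matrix (Fin w) (Fin w) ℝ) j k := by
  have := hK.sq_second_moment j k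
  rw [Matrix.smul_apply, smul_eq_mul] at this
  rw [← this]
  refine integral_congr_ae (Eventually.of_forall fun u => ?_)
  simp only [PiLp.smul_apply, smul_eq_mul]
  ring

theorem KernelAssumption.hasCompactSupport_mul (hK : KernelAssumption K μ₂ ν₀ ν₂) (ψ : E w → ℝ) :
    HasCompactSupport fun u => K u * ψ u := hK.compact_support.mul_right

theorem KernelAssumption.continuous_coord (hK : KernelAssumption K μ₂ ν₀ ν₂) (j : Fin w) :
    Continuous fun u : E w => (K u • u) j := by
  have := hK.continuous
  fun_prop

theorem KernelAssumption.hasCompactSupport_coord (hK : KernelAssumption K μ₂ ν₀ ν₂) (j : Fin w) :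
    HasCompactSupport fun u : E w => (K u • u) j := by
  simpa using hK.hasCompactSupport_mul fun u => u j

/-- The centred quadratic form has mean zero under the kernel. -/
theorem KernelAssumption.integral_quadratic (hK : KernelAssumption K μ₂ ν₀ ν₂)
    (H : Matrix (Fin w) (Fin w) ℝ) :
    ∫ u : E w, K u * (1 / 2 * (∑ j, ∑ k, u j * u k * H j k - H.trace * μ₂)) = 0 := by
  have hc := hK.continuous
  have hi : ∀ j k, Integrable fun u : E w => u j * u k * K u := fun j k => by
    refine Continuous.integrable_of_hasCompactSupport (by fun_prop) ?_
    simpa [mul_comm] using hK.hasCompactSupport_mul fun u => u j * u k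
  have hKi : Integrable K := hc.integrable_of_hasCompactSupport hK.compact_support
  have e : ∀ u : E w, K u * (1 / 2 * (∑ j, ∑ k, u j * u k * H j k - H.trace * μ₂)) =
      1 / 2 * (∑ j, ∑ k, H j k * (u j * u k * K u) - H.trace * μ₂ * K u) := by
    intro u
    have : ∑ j, ∑ k, H j k * (u j * u k * K u) = K u * ∑ j, ∑ k, u j * u k * H j k := by
      simp only [Finset.mul_sum]
      exact Finset.sum_congr rfl fun j _ => Finset.sum_congr rfl fun k _ => by ring
    rw [this]; ring
  have hi' : ∀ j, Integrable fun u : E w => ∑ k, H j k * (u j * u k * K u) := fun j =>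
    integrable_finsetSum _ fun k _ => (hi j k).const_mul _
  have hj : ∀ j, ∫ u : E w, ∑ k, H j k * (u j * u k * K u) = H j j * μ₂ := by
    intro j
    rw [integral_finsetSum _ fun k _ => (hi j k).const_mul _]
    simp_rw [integral_const_mul, hK.second_moment]
    simp [Matrix.one_apply]
  have hsum : ∫ u : E w, ∑ j, ∑ k, H j k * (u j * u k * K u) = H.trace * μ₂ := by
    rw [integral_finsetSum _ fun j _ => hi' j]
    simp only [hj, ← Finset.sum_mul]
    simp [Matrix.trace]
  have hsub := integral_sub (integrable_finsetSum Finset.univ fun j _ => hi' j)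
    (hKi.const_mul (H.trace * μ₂))
  rw [hsum, integral_const_mul, hK.integral_one] at hsub
  rw [integral_congr_ae (Eventually.of_forall e), integral_const_mul, hsub]
  ring

end Score

/-! ### Population tilt and sample tilt. -/

section Solutions

variable {Ω : Type*} [MeasurableSpace Ω] {μ : Measure Ω} {w : ℕ}
  {X : ℕ → Ω → E w} {γ : ℝ} {x : E w} {h : ℕ → ℝ} {K : E w → ℝ} {μ₂ ν₀ ν₂ δ : ℝ}

/-- The population version of the first order condition is solvable near zero. -/
theorem exists_population_tilt [IsProbabilityMeasure μ] (hX : Measurable (X 0)) (hw : 1 ≤ w)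
    (hγ : 0 < γ) (hh : BandwidthAssumption w δ h) (hK : KernelAssumption K μ₂ ν₀ ν₂)
    (hmean : ∀ φ : E w → ℝ, Continuous φ → HasCompactSupport φ →
      Tendsto (fun n => (h n ^ w)⁻¹ * ∫ ω, φ ((h n)⁻¹ • (X 0 ω - x)) ∂μ) atTop
        (𝓝 (γ * ∫ u, φ u)))
    {C r : ℝ} (hC : ∀ (h : ℝ) (x z : E w), ‖score K h x z‖ ≤ C) (hr : 0 < r)
    (hrC : r * C ≤ 1 / 8) :
    ∀ᶠ n in atTop, ∃ l : E w, ‖l‖ < r ∧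
      ∀ e : E w, ∫ ω, ⟪e, score K (h n) x (X 0 ω)⟫ / (1 + ⟪l, score K (h n) x (X 0 ω)⟫) ∂μ = 0 := by
  have hw' : (0 : ℝ) < w := by exact_mod_cast hw
  have hc0 : 0 < γ * ν₂ := mul_pos hγ hK.sq_second_moment_pos
  -- The mean score vanishes in the limit because `∫ u K = 0`; the threshold is half of what
  -- `exists_tilt_of_moments` allows.
  have h1 : ∀ j, ∀ᶠ n in atTop, |(h n ^ w)⁻¹ * ∫ ω, score K (h n) x (X 0 ω) j ∂μ| ≤
      γ * ν₂ * r / (16 * w) := by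
    intro j
    have := hmean _ (hK.continuous_coord j) (hK.hasCompactSupport_coord j)
    rw [hK.integral_coord, mul_zero] at this
    filter_upwards [Metric.tendsto_nhds.mp this (γ * ν₂ * r / (16 * w)) (by positivity)] with n hn
    rw [Real.dist_eq, sub_zero] at hn
    exact hn.le
  have h2 : ∀ j k, ∀ᶠ n in atTop, |(h n ^ w)⁻¹ * ∫ ω, score K (h n) x (X 0 ω) j *
      score K (h n) x (X 0 ω) k ∂μ - γ * ν₂ * (1 : Matrix (Fin w) (Fin w) ℝ) j k| ≤
      γ * ν₂ / (2 * w ^ 2) := by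
    intro j k
    have := hmean _ ((hK.continuous_coord j).mul (hK.continuous_coord k))
      (hK.hasCompactSupport_coord j).mul_right
    simp only [Pi.mul_apply] at this
    rw [hK.integral_coord_mul, ← mul_assoc] at this
    filter_upwards [Metric.tendsto_nhds.mp this (γ * ν₂ / (2 * w ^ 2)) (by positivity)] with n hn
    exact hn.le
  filter_upwards [eventually_all.mpr h1,
    eventually_all.mpr fun j => eventually_all.mpr (h2 j)] with n hn1 hn2
  -- Here the measure is the law of one observation and the normalization is `h^w`.
  refine (exists_tilt_of_moments μ (W := fun ω => score K (h n) x (X 0 ω))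
    ((hK.measurable_score _ _).comp hX) (fun ω => hC _ _ _) hr hrC hw (pow_pos (hh.pos n) w)
    hn1 hn2 ?_).2
  have : (w : ℝ) * (γ * ν₂ * r / (16 * w)) = γ * ν₂ * r / 16 := by field_simp
  rw [this]
  have : 0 < γ * ν₂ * r := by positivity
  linarith

/-- The adjustment weights exist and have the exponential tilting form with probability tending to
one. -/
theorem likely_adjustmentWeights (hw : 1 ≤ w) (hγ : 0 < γ) (hh : BandwidthAssumption w δ h)
    (hK : KernelAssumption K μ₂ ν₀ ν₂)
    (hlln : ∀ φ : E w → ℝ, Continuous φ → HasCompactSupport φ → ∀ ε : ℝ, 0 < ε →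
      Likely μ fun n ω => |((n : ℝ) * h n ^ w)⁻¹ *
        ∑ i ∈ Finset.range n, φ ((h n)⁻¹ • (X i ω - x)) - γ * ∫ u, φ u| ≤ ε)
    {p : ∀ n : ℕ, Ω → Fin n → ℝ}
    (hp : ∀ (n : ℕ) (ω : Ω),
      (∃ q, IsAdjustmentWeights K (h n) x (fun i : Fin n => X i ω) q) →
        IsAdjustmentWeights K (h n) x (fun i : Fin n => X i ω) (p n ω))
    {C r : ℝ} (hC : ∀ (h : ℝ) (x z : E w), ‖score K h x z‖ ≤ C) (hr : 0 < r)
    (hrC : r * C ≤ 1 / 8) :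
    Likely μ fun n ω =>
      (∀ e : E w, γ * ν₂ / 2 * (n * h n ^ w) * ‖e‖ ^ 2 ≤
        ∑ i : Fin n, ⟪e, score K (h n) x (X i ω)⟫ ^ 2) ∧
      ∃ l : E w, ‖l‖ < r ∧
        (∀ e : E w, ∑ i : Fin n, ⟪e, score K (h n) x (X i ω)⟫ /
          (1 + ⟪l, score K (h n) x (X i ω)⟫) = 0) ∧
        ∀ i : Fin n, p n ω i = (n * (1 + ⟪l, score K (h n) x (X i ω)⟫))⁻¹ := by
  have hw' : (0 : ℝ) < w := by exact_mod_cast hw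
  have hc0 : 0 < γ * ν₂ := mul_pos hγ hK.sq_second_moment_pos
  have h1 := Likely.forall fun j => hlln _ (hK.continuous_coord j) (hK.hasCompactSupport_coord j)
    (γ * ν₂ * r / (16 * w)) (by positivity)
  have h2 := Likely.forall fun j => Likely.forall fun k =>
    hlln _ ((hK.continuous_coord j).mul (hK.continuous_coord k))
      (hK.hasCompactSupport_coord j).mul_right (γ * ν₂ / (2 * w ^ 2)) (by positivity)
  refine (h1.and h2).mono ?_
  filter_upwards [eventually_gt_atTop 0] with n hn ω hω
  obtain ⟨hω1, hω2⟩ := hω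
  have hn' : (0 : ℝ) < n := by exact_mod_cast hn
  have hm1 : ∀ j, |((n : ℝ) * h n ^ w)⁻¹ * ∫ i : Fin n, score K (h n) x (X i ω) j
      ∂Measure.count| ≤ γ * ν₂ * r / (16 * w) := by
    intro j
    have := hω1 j
    rw [hK.integral_coord, mul_zero, sub_zero, Finset.sum_range] at this
    rw [integral_count]
    exact this
  have hm2 : ∀ j k, |((n : ℝ) * h n ^ w)⁻¹ * ∫ i : Fin n, score K (h n) x (X i ω) j *
      score K (h n) x (X i ω) k ∂Measure.count -
        γ * ν₂ * (1 : Matrix (Fin w) (Fin w) ℝ) j k| ≤ γ * ν₂ / (2 * w ^ 2) := by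
    intro j k
    have := hω2 j k
    simp only [Pi.mul_apply] at this
    rw [hK.integral_coord_mul, ← mul_assoc, Finset.sum_range] at this
    rw [integral_count]
    exact this
  have hs : (w : ℝ) * (γ * ν₂ * r / (16 * w)) < γ * ν₂ * r / 8 := by
    have : (w : ℝ) * (γ * ν₂ * r / (16 * w)) = γ * ν₂ * r / 16 := by field_simp
    rw [this]
    have : 0 < γ * ν₂ * r := by positivity
    linarith
  -- The sample version of the argument for the population: counting measure on the sample,
  -- normalization `n h^w`.
  obtain ⟨hq, l, hl, hfoc⟩ := exists_tilt_of_moments (Measure.count : Measure (Fin n))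
    (W := fun i => score K (h n) x (X i ω)) (measurable_of_finite _)
    (fun i => hC _ _ _) hr hrC hw (mul_pos hn' (pow_pos (hh.pos n) w)) hm1 hm2 hs
  simp only [integral_count] at hq hfoc
  refine ⟨hq, l, hl, hfoc, (adjustmentWeights_eq K (hh.pos n) x _ hn (fun i => ?_) hfoc
    (hp n ω)).2⟩
  have := abs_le.mp (abs_inner_le_of_mul_le (hC (h n) x (X i ω)) hl.le hrC)
  change 0 < 1 + ⟪l, score K (h n) x (X i ω)⟫
  linarith

end Solutions

/-! ### Deterministic bounds for bias and noise. -/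

section Decomposition

variable {w n : ℕ}

/-- Deterministic bound of the bias part of the estimator. -/
theorem abs_bias_le {K F : E w → ℝ} {h : ℝ} (hh : 0 < h) {x : E w} {xs : Fin n → E w}
    (hK : ∀ u, 0 ≤ K u) {C r R B η τ N s : ℝ} {γ : ℝ} (hγ : 0 < γ) (hN : 0 < N) {l : E w}
    (hC : ∀ z, ‖score K h x z‖ ≤ C) (hl : ‖l‖ ≤ r) (hrC : r * C ≤ 1 / 8)
    (hR : ∀ u, K u ≠ 0 → ‖u‖ ≤ R) (hB0 : 0 ≤ B) (L : E w →L[ℝ] ℝ) (Q : E w → ℝ)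
    (hF : ∀ u, ‖u‖ ≤ R → |F (x + h • u) - F x - h * L u - 1 / 2 * h ^ 2 * Q u| ≤ η * h ^ 2)
    (hQ : ∀ u, ‖u‖ ≤ R → |1 / 2 * (Q u - τ)| ≤ B)
    (hfoc : ∀ e : E w, ∑ i, ⟪e, score K h x (xs i)⟫ / (1 + ⟪l, score K h x (xs i)⟫) = 0)
    (hden : γ / 2 ≤ N⁻¹ * ∑ i, K (h⁻¹ • (xs i - x)))
    (hnum : |N⁻¹ * ∑ i, K (h⁻¹ • (xs i - x)) * (1 / 2 * (Q (h⁻¹ • (xs i - x)) - τ))| ≤ s) :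
    |∑ i, K (h⁻¹ • (xs i - x)) / (1 + ⟪l, score K h x (xs i)⟫) /
        (∑ j, K (h⁻¹ • (xs j - x)) / (1 + ⟪l, score K h x (xs j)⟫)) * (F (xs i) - F x) -
      1 / 2 * h ^ 2 * τ| ≤ (4 * s / γ + 4 * B * (r * C) + η) * h ^ 2 := by
  set u : Fin n → E w := fun i => h⁻¹ • (xs i - x) with hu
  set k : Fin n → ℝ := fun i => K (u i) with hk
  set a : Fin n → ℝ := fun i => ⟪l, score K h x (xs i)⟫ with ha
  change |∑ i, k i / (1 + a i) / (∑ j, k j / (1 + a j)) * (F (xs i) - F x) -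
      1 / 2 * h ^ 2 * τ| ≤ _
  change γ / 2 ≤ N⁻¹ * ∑ i, k i at hden
  change |N⁻¹ * ∑ i, k i * (1 / 2 * (Q (u i) - τ))| ≤ s at hnum
  have hk0 : ∀ i, 0 ≤ k i := fun i => hK _
  have ha8 : ∀ i, |a i| ≤ 1 / 8 := fun i => abs_inner_le_of_mul_le (hC _) hl hrC
  have hapos : ∀ i, 0 < 1 + a i := fun i => by have := abs_le.mp (ha8 i); linarith
  set T := ∑ j, k j / (1 + a j) with hT
  have hTk : 1 / 2 * ∑ i, k i ≤ T := mul_sum_le_sum_div hk0 ha8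
  have hSN : γ / 2 * N ≤ ∑ i, k i := by
    rw [← div_eq_inv_mul, le_div_iff₀ hN] at hden; exact hden
  have hTN : γ / 4 * N ≤ T := by linarith
  have hT0 : 0 < T := lt_of_lt_of_le (by positivity) hTN
  have hq0 : ∀ i, 0 ≤ k i / (1 + a i) := fun i => div_nonneg (hk0 i) (hapos i).le
  have hx : ∀ i, xs i = x + h • u i := fun i => by
    simp [hu, smul_smul, mul_inv_cancel₀ hh.ne']
  -- The balance constraint tested against the Riesz representer of the gradient: the linear Taylor
  -- term disappears exactly, as for a local linear fit.
  have hlin : ∑ i, k i / (1 + a i) * L (u i) = 0 := by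
    rw [← hfoc ((InnerProductSpace.toDual ℝ (E w)).symm L)]
    refine Finset.sum_congr rfl fun i _ => ?_
    rw [InnerProductSpace.toDual_symm_apply]
    simp only [score, map_smul, smul_eq_mul, hk, hu, ha]
    ring
  set ψ : Fin n → ℝ := fun i => 1 / 2 * (Q (u i) - τ) with hψ
  set rem : Fin n → ℝ := fun i => F (xs i) - F x - h * L (u i) - 1 / 2 * h ^ 2 * Q (u i) with hrem
  have e1 : ∑ i, k i / (1 + a i) / T * (F (xs i) - F x) - 1 / 2 * h ^ 2 * τ =
      T⁻¹ * (h ^ 2 * ∑ i, k i / (1 + a i) * ψ i + ∑ i, k i / (1 + a i) * rem i) := by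
    have e2 : ∑ i, k i / (1 + a i) * (F (xs i) - F x) = h * (∑ i, k i / (1 + a i) * L (u i)) +
        h ^ 2 * ∑ i, k i / (1 + a i) * ψ i + ∑ i, k i / (1 + a i) * rem i +
        1 / 2 * h ^ 2 * τ * T := by
      rw [hT, Finset.mul_sum, Finset.mul_sum, Finset.mul_sum, ← Finset.sum_add_distrib,
        ← Finset.sum_add_distrib, ← Finset.sum_add_distrib]
      refine Finset.sum_congr rfl fun i _ => ?_
      simp only [hψ, hrem]
      ring
    have e3 : ∑ i, k i / (1 + a i) / T * (F (xs i) - F x) =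
        T⁻¹ * ∑ i, k i / (1 + a i) * (F (xs i) - F x) := by
      rw [Finset.mul_sum]
      exact Finset.sum_congr rfl fun i _ => by rw [div_eq_mul_inv _ T]; ring
    rw [e3, e2, hlin]
    field_simp
    ring
  have b1 : |∑ i, k i / (1 + a i) * rem i| ≤ η * h ^ 2 * T := by
    rw [hT, Finset.mul_sum]
    refine (Finset.abs_sum_le_sum_abs _ _).trans (Finset.sum_le_sum fun i _ => ?_)
    rw [abs_mul, abs_of_nonneg (hq0 i), mul_comm]
    rcases eq_or_ne (k i) 0 with h0 | h0
    · simp [h0]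
    · refine mul_le_mul_of_nonneg_right ?_ (hq0 i)
      have := hF (u i) (hR _ h0)
      rwa [← hx i] at this
  -- Comparison with the untilted sum: dropping the tilt costs `2 B (r C) ∑ k`, and the untilted
  -- average is small by hypothesis.
  have b2 : |∑ i, k i / (1 + a i) * ψ i| ≤ N * s + 2 * B * (r * C) * ∑ i, k i := by
    have h1 := abs_sum_div_sub_sum_div_le (b := fun _ => 0) (e := ψ) (t := r * C) hk0 ha8
      (by simp) (fun i h0 => hQ (u i) (hR _ h0)) (fun i => ?_) hB0
    · simp only [add_zero, div_one] at h1
      rw [abs_mul, abs_of_pos (inv_pos.mpr hN), ← div_eq_inv_mul, div_le_iff₀ hN] at hnum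
      have h2 := abs_add_le (∑ i, k i / (1 + a i) * ψ i - ∑ i, k i * ψ i) (∑ i, k i * ψ i)
      rw [sub_add_cancel] at h2
      linarith
    · rw [zero_sub, abs_neg]
      exact (abs_real_inner_le_norm _ _).trans
        (mul_le_mul hl (hC _) (norm_nonneg _) ((norm_nonneg _).trans hl))
  have hs0 : 0 ≤ s := (abs_nonneg _).trans hnum
  have hrC0 : 0 ≤ r * C :=
    mul_nonneg ((norm_nonneg _).trans hl) ((norm_nonneg _).trans (hC x))
  rw [e1, abs_mul, abs_of_pos (inv_pos.mpr hT0), ← div_eq_inv_mul, div_le_iff₀ hT0]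
  -- Division by `T` uses `T ≥ γ N / 4` here and `∑ k ≤ 2 T` next.
  have b3 : N * s ≤ 4 * s / γ * T := by
    rw [div_mul_eq_mul_div, le_div_iff₀ hγ]
    nlinarith
  have b4 : 2 * B * (r * C) * ∑ i, k i ≤ 4 * B * (r * C) * T := by
    have : 0 ≤ B * (r * C) := by positivity
    nlinarith
  calc _ ≤ |h ^ 2 * ∑ i, k i / (1 + a i) * ψ i| + |∑ i, k i / (1 + a i) * rem i| := abs_add_le _ _
    _ ≤ h ^ 2 * (4 * s / γ * T + 4 * B * (r * C) * T) + η * h ^ 2 * T := by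
        rw [abs_mul, abs_of_pos (by positivity : 0 < h ^ 2)]
        refine add_le_add (mul_le_mul_of_nonneg_left ?_ (by positivity)) b1
        linarith
    _ = _ := by ring

/-- Deterministic bound of the noise part of the estimator. -/
theorem abs_noise_le {K : E w → ℝ} {h : ℝ} {x : E w} {xs : Fin n → E w}
    (hK : ∀ u, 0 ≤ K u) {C r N γ v : ℝ} (hγ : 0 < γ) (hv : 0 < v) (hN : 0 < N) {l l' : E w}
    (hC : ∀ z, ‖score K h x z‖ ≤ C) (hl : ‖l‖ ≤ r) (hl' : ‖l'‖ ≤ r) (hrC : r * C ≤ 1 / 8)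
    {e : Fin n → ℝ} (he : ∀ i, |e i| ≤ 1)
    (hfoc : ∀ e : E w, ∑ i, ⟪e, score K h x (xs i)⟫ / (1 + ⟪l, score K h x (xs i)⟫) = 0)
    (hquad : ∀ e : E w, v * N * ‖e‖ ^ 2 ≤ ∑ i, ⟪e, score K h x (xs i)⟫ ^ 2)
    (hden : γ / 2 ≤ N⁻¹ * ∑ i, K (h⁻¹ • (xs i - x))) :
    |∑ i, K (h⁻¹ • (xs i - x)) / (1 + ⟪l, score K h x (xs i)⟫) /
        (∑ j, K (h⁻¹ • (xs j - x)) / (1 + ⟪l, score K h x (xs j)⟫)) * e i| ≤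
      (4 / γ + 8 * C / v) *
        (|N⁻¹ * ∑ i, K (h⁻¹ • (xs i - x)) / (1 + ⟪l', score K h x (xs i)⟫) * e i| +
          ∑ j, |N⁻¹ * ∑ i, score K h x (xs i) j / (1 + ⟪l', score K h x (xs i)⟫)|) := by
  set k : Fin n → ℝ := fun i => K (h⁻¹ • (xs i - x)) with hk
  set a : Fin n → ℝ := fun i => ⟪l, score K h x (xs i)⟫ with ha
  set b : Fin n → ℝ := fun i => ⟪l', score K h x (xs i)⟫ with hb
  change |∑ i, k i / (1 + a i) / (∑ j, k j / (1 + a j)) * e i| ≤ (4 / γ + 8 * C / v) *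
    (|N⁻¹ * ∑ i, k i / (1 + b i) * e i| + ∑ j, |N⁻¹ * ∑ i, score K h x (xs i) j / (1 + b i)|)
  change γ / 2 ≤ N⁻¹ * ∑ i, k i at hden
  have hk0 : ∀ i, 0 ≤ k i := fun i => hK _
  have ha8 : ∀ i, |a i| ≤ 1 / 8 := fun i => abs_inner_le_of_mul_le (hC _) hl hrC
  have hb8 : ∀ i, |b i| ≤ 1 / 8 := fun i => abs_inner_le_of_mul_le (hC _) hl' hrC
  have hC0 : 0 ≤ C := (norm_nonneg _).trans (hC x)
  set T := ∑ j, k j / (1 + a j) with hT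
  have hTk : 1 / 2 * ∑ i, k i ≤ T := mul_sum_le_sum_div hk0 ha8
  have hSN : γ / 2 * N ≤ ∑ i, k i := by
    rw [← div_eq_inv_mul, le_div_iff₀ hN] at hden; exact hden
  have hTN : γ / 4 * N ≤ T := by linarith
  have hT0 : 0 < T := lt_of_lt_of_le (by positivity) hTN
  set q := ∑ j, |N⁻¹ * ∑ i, score K h x (xs i) j / (1 + b i)| with hq
  have hq0 : 0 ≤ q := Finset.sum_nonneg fun _ _ => abs_nonneg _
  -- The reference tilt `l'` satisfies the sample first order condition up to an error `N q`, so
  -- stability bounds its distance to `l`.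
  have hd : v * ‖l - l'‖ ≤ 2 * q := by
    have h1 := norm_sub_tilt_le (z := fun i => score K h x (xs i)) (s := N * q) (v := v * N)
      (by positivity) (fun i => hC _) hrC hl hl' hfoc (fun d => ?_) hquad
    · have : N * (v * ‖l - l'‖) ≤ N * (2 * q) := by linarith
      exact le_of_mul_le_mul_left this hN
    · have e1 : ∑ i, ⟪d, score K h x (xs i)⟫ / (1 + b i) =
          ∑ j, d j * (N * (N⁻¹ * ∑ i, score K h x (xs i) j / (1 + b i))) := by
        simp only [inner_eq_sum, mul_inv_cancel_left₀ hN.ne', Finset.sum_div, Finset.mul_sum]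
        rw [Finset.sum_comm]
        exact Finset.sum_congr rfl fun j _ => Finset.sum_congr rfl fun i _ => mul_div_assoc _ _ _
      change |∑ i, ⟪d, score K h x (xs i)⟫ / (1 + b i)| ≤ _
      rw [e1, hq, Finset.mul_sum, Finset.sum_mul]
      refine (Finset.abs_sum_le_sum_abs _ _).trans (Finset.sum_le_sum fun j _ => ?_)
      rw [abs_mul, abs_mul, abs_of_pos hN, mul_comm]
      exact mul_le_mul_of_nonneg_left (abs_coord_le d j) (by positivity)
  set t := ‖l - l'‖ * C with ht
  -- Replacing `l` by `l'` in the noise sum costs a multiple of `‖l - l'‖`, which is already of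
  -- order `q`.
  have hdiff : |∑ i, k i / (1 + a i) * e i - ∑ i, k i / (1 + b i) * e i| ≤
      2 * 1 * t * ∑ i, k i := by
    refine abs_sum_div_sub_sum_div_le hk0 ha8 hb8 (fun i _ => he i) (fun i => ?_) zero_le_one
    rw [abs_sub_comm]
    simp only [ha, hb]
    rw [← inner_sub_left]
    exact (abs_real_inner_le_norm _ _).trans (mul_le_mul_of_nonneg_left (hC _) (norm_nonneg _))
  set Q := N⁻¹ * ∑ i, k i / (1 + b i) * e i with hQ
  have hQN : ∑ i, k i / (1 + b i) * e i = N * Q := by rw [hQ, mul_inv_cancel_left₀ hN.ne']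
  rw [hQN] at hdiff
  have e3 : ∑ i, k i / (1 + a i) / T * e i = T⁻¹ * ∑ i, k i / (1 + a i) * e i := by
    rw [Finset.mul_sum]
    exact Finset.sum_congr rfl fun i _ => by rw [div_eq_mul_inv _ T]; ring
  have h2 := abs_add_le (∑ i, k i / (1 + a i) * e i - N * Q) (N * Q)
  rw [sub_add_cancel, abs_mul N, abs_of_pos hN] at h2
  have ht0 : 0 ≤ t := by positivity
  have ht1 : t ≤ 2 * C / v * q := by
    rw [div_mul_eq_mul_div, le_div_iff₀ hv]
    nlinarith
  have hNQ : N * |Q| ≤ 4 / γ * |Q| * T := by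
    have : N ≤ 4 / γ * T := by
      rw [div_mul_eq_mul_div, le_div_iff₀ hγ]; linarith
    nlinarith [abs_nonneg Q]
  have htT : 2 * 1 * t * ∑ i, k i ≤ 4 * t * T := by nlinarith
  rw [e3, abs_mul, abs_of_pos (inv_pos.mpr hT0), ← div_eq_inv_mul, div_le_iff₀ hT0]
  have hcoef : 4 / γ * |Q| + 4 * t ≤ (4 / γ + 8 * C / v) * (|Q| + q) := by
    have h3 : 0 ≤ 4 / γ * q := by positivity
    have h4 : 0 ≤ 8 * C / v * |Q| := by positivity
    have h5 : 8 * C / v * q = 4 * (2 * C / v * q) := by ring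
    nlinarith
  calc _ ≤ 4 * t * T + 4 / γ * |Q| * T := by linarith
    _ = (4 / γ * |Q| + 4 * t) * T := by ring
    _ ≤ _ := mul_le_mul_of_nonneg_right hcoef hT0.le

end Decomposition

theorem abs_indicator_sub_condCDF_le {w : ℕ} (κ : Kernel (E w) ℝ) [IsMarkovKernel κ] (y b : ℝ)
    (z : E w) : |Set.indicator (Set.Iic y) (fun _ => (1 : ℝ)) b - condCDF κ y z| ≤ 1 := by
  have h1 : 0 ≤ condCDF κ y z := measureReal_nonneg
  have h2 : condCDF κ y z ≤ 1 := measureReal_le_one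
  rw [abs_le]
  by_cases hb : b ∈ Set.Iic y
  · rw [Set.indicator_of_mem hb]; constructor <;> linarith
  · rw [Set.indicator_of_notMem hb]; constructor <;> linarith

/-! ### Bias and noise of the estimator. -/

section Estimator

variable {Ω : Type*} [MeasurableSpace Ω] {μ : Measure Ω} {w : ℕ}
  {X : ℕ → Ω → E w} {Y : ℕ → Ω → ℝ} {γ : ℝ} {x : E w} {h : ℕ → ℝ} {K : E w → ℝ}
  {μ₂ ν₀ ν₂ δ : ℝ}

theorem likely_density_le (hγ : 0 < γ) (hK : KernelAssumption K μ₂ ν₀ ν₂)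
    (hlln : ∀ φ : E w → ℝ, Continuous φ → HasCompactSupport φ → ∀ ε : ℝ, 0 < ε →
      Likely μ fun n ω => |((n : ℝ) * h n ^ w)⁻¹ *
        ∑ i ∈ Finset.range n, φ ((h n)⁻¹ • (X i ω - x)) - γ * ∫ u, φ u| ≤ ε) :
    Likely μ fun n ω => γ / 2 ≤ ((n : ℝ) * h n ^ w)⁻¹ *
      ∑ i : Fin n, K ((h n)⁻¹ • (X i ω - x)) := by
  refine (hlln K hK.continuous hK.compact_support (γ / 2) (half_pos hγ)).mono
    (Eventually.of_forall fun n ω hω => ?_)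
  rw [hK.integral_one, mul_one, Finset.sum_range] at hω
  linarith [(abs_le.mp hω).1]

/-- The noise part of the estimator. -/
noncomputable def noise (κ : Kernel (E w) ℝ) (K : E w → ℝ) (h : ℕ → ℝ) (x : E w) (y : ℝ)
    (X : ℕ → Ω → E w) (Y : ℕ → Ω → ℝ) (p : ∀ n : ℕ, Ω → Fin n → ℝ) (n : ℕ) (ω : Ω) : ℝ :=
  ∑ i : Fin n, finalWeight K (h n) x (fun i : Fin n => X i ω) (p n ω) i *
    (Set.indicator (Set.Iic y) (fun _ => (1 : ℝ)) (Y i ω) - condCDF κ y (X i ω))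

/-- The estimator without its noise part has the asymptotic bias of the local linear estimator. -/
theorem likely_bias_le (hw : 1 ≤ w) (hγ : 0 < γ) (hh : BandwidthAssumption w δ h)
    (hK : KernelAssumption K μ₂ ν₀ ν₂) (κ : Kernel (E w) ℝ) {y : ℝ}
    (hsm : ContDiffAt ℝ 2 (fun z => condCDF κ y z) x)
    (hlln : ∀ φ : E w → ℝ, Continuous φ → HasCompactSupport φ → ∀ ε : ℝ, 0 < ε →
      Likely μ fun n ω => |((n : ℝ) * h n ^ w)⁻¹ *
        ∑ i ∈ Finset.range n, φ ((h n)⁻¹ • (X i ω - x)) - γ * ∫ u, φ u| ≤ ε)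
    {p : ∀ n : ℕ, Ω → Fin n → ℝ}
    (hp : ∀ (n : ℕ) (ω : Ω),
      (∃ q, IsAdjustmentWeights K (h n) x (fun i : Fin n => X i ω) q) →
        IsAdjustmentWeights K (h n) x (fun i : Fin n => X i ω) (p n ω))
    {ε : ℝ} (hε : 0 < ε) :
    Likely μ fun n ω =>
      |estimator K (h n) x (fun i : Fin n => X i ω) (fun i : Fin n => Y i ω) (p n ω) y -
        condCDF κ y x - 1 / 2 * h n ^ 2 * (hessian (fun z => condCDF κ y z) x).trace * μ₂ -
        noise κ K h x y X Y p n ω| ≤ ε * h n ^ 2 := by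
  set F : E w → ℝ := fun z => condCDF κ y z with hF
  obtain ⟨C, hC0, hC⟩ := hK.exists_norm_le
  obtain ⟨R, hR0, hR⟩ := hK.exists_radius
  set D := fderiv ℝ (fderiv ℝ F) x with hD
  set τ := (hessian F x).trace * μ₂ with hτ
  set B := 1 / 2 * (‖D‖ * R * R + |τ|) with hB
  have hB0 : 0 ≤ B := by positivity
  have hQ : ∀ u : E w, ‖u‖ ≤ R → |1 / 2 * (D u u - τ)| ≤ B := by
    intro u hu
    rw [abs_mul, abs_of_pos (by norm_num : (0 : ℝ) < 1 / 2), hB]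
    refine mul_le_mul_of_nonneg_left ((abs_sub _ _).trans (add_le_add ?_ le_rfl)) (by norm_num)
    refine (D.le_opNorm₂ u u).trans ?_
    gcongr
  -- The bound of `abs_bias_le` has three terms; `η`, the radius `r` and the threshold `s` are
  -- chosen to make each at most `ε / 3`.
  set η := ε / 3 / (R ^ 2 + 1) with hη
  have hη0 : 0 < η := by positivity
  obtain ⟨ρ, hρ, htay⟩ := exists_taylor_two hsm hη0
  set r := min (1 / 8) (ε / (12 * (B + 1))) / (C + 1) with hr
  have hr0 : 0 < r := by positivity
  have hrC' : r * C ≤ min (1 / 8) (ε / (12 * (B + 1))) := by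
    rw [hr, div_mul_eq_mul_div, div_le_iff₀ (by positivity)]
    have : 0 < min (1 / 8 : ℝ) (ε / (12 * (B + 1))) := by positivity
    nlinarith
  have hrC : r * C ≤ 1 / 8 := hrC'.trans (min_le_left _ _)
  have hrB : 4 * B * (r * C) ≤ ε / 3 := by
    have h1 := hrC'.trans (min_le_right _ _)
    rw [le_div_iff₀ (by positivity)] at h1
    have : 0 ≤ r * C := by positivity
    nlinarith
  set s := γ * ε / 12 with hs
  have hφ : Continuous fun u : E w => K u * (1 / 2 * (D u u - τ)) := by
    have := hK.continuous
    fun_prop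
  have hint : ∫ u : E w, K u * (1 / 2 * (D u u - τ)) = 0 := by
    simp only [hD, hessian_sum_eq hsm, hτ]
    exact hK.integral_quadratic _
  have hl1 := hlln _ hφ (hK.hasCompactSupport_mul _) s (by positivity)
  refine ((likely_density_le hγ hK hlln).and (hl1.and
    (likely_adjustmentWeights hw hγ hh hK hlln hp hC hr0 hrC))).mono ?_
  filter_upwards [eventually_gt_atTop 0, hh.eventually_mul_lt R hρ] with n hn hnρ ω hω
  obtain ⟨hden, hnum, -, l, hl, hfoc, hpw⟩ := hω
  rw [hint, mul_zero, sub_zero, Finset.sum_range] at hnum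
  have h0 := hh.pos n
  have hN : 0 < (n : ℝ) * h n ^ w := mul_pos (by exact_mod_cast hn) (pow_pos h0 w)
  have hbias := abs_bias_le (xs := fun i : Fin n => X i ω) (F := F) h0 hK.nonneg hγ hN (hC _ _)
    hl.le hrC hR hB0 (fderiv ℝ F x) (fun u => D u u) (η := ε / 3) (fun u hu => ?_) hQ hfoc hden hnum
  · have hfw := finalWeight_eq K h0 x (fun i : Fin n => X i ω) hn hpw
    set T := ∑ j : Fin n, K ((h n)⁻¹ • (X j ω - x)) / (1 + ⟪l, score K (h n) x (X j ω)⟫) with hT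
    have hT0 : 0 < T := by
      have h1 : 1 / 2 * ∑ i : Fin n, K ((h n)⁻¹ • (X i ω - x)) ≤ T :=
        mul_sum_le_sum_div (fun i => hK.nonneg _)
          fun i => abs_inner_le_of_mul_le (hC _ _ _) hl.le hrC
      rw [← div_eq_inv_mul, le_div_iff₀ hN] at hden
      have : 0 < γ / 2 * ((n : ℝ) * h n ^ w) := by positivity
      linarith
    -- The final weights sum to one, so `F x` can be moved inside the weighted sum.
    have hsum : ∑ i : Fin n, finalWeight K (h n) x (fun i : Fin n => X i ω) (p n ω) i = 1 := by
      simp only [hfw]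
      rw [← Finset.sum_div, div_self hT0.ne']
    have e1 : estimator K (h n) x (fun i : Fin n => X i ω) (fun i : Fin n => Y i ω) (p n ω) y -
        condCDF κ y x - 1 / 2 * h n ^ 2 * (hessian F x).trace * μ₂ - noise κ K h x y X Y p n ω =
        ∑ i : Fin n, finalWeight K (h n) x (fun i : Fin n => X i ω) (p n ω) i *
          (F (X i ω) - F x) - 1 / 2 * h n ^ 2 * τ := by
      simp only [estimator, noise, mul_sub, Finset.sum_sub_distrib, ← Finset.sum_mul, hsum, hF, hτ]
      ring
    rw [e1]
    simp only [hfw]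
    refine hbias.trans (mul_le_mul_of_nonneg_right ?_ (by positivity))
    have : 4 * s / γ = ε / 3 := by rw [hs]; field_simp; norm_num
    linarith
  · have h1 := htay (h n • u) (by
      rw [norm_smul, Real.norm_of_nonneg h0.le]
      exact lt_of_le_of_lt (by rw [mul_comm]; gcongr) hnρ)
    rw [norm_smul, Real.norm_of_nonneg h0.le] at h1
    simp only [map_smul, _root_.smul_apply, smul_eq_mul] at h1
    have e : F (x + h n • u) - F x - h n * fderiv ℝ F x u - 1 / 2 * h n ^ 2 * D u u =
        F (x + h n • u) - F x - h n * fderiv ℝ F x u - 1 / 2 * (h n * (h n * D u u)) := by ring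
    rw [e]
    refine h1.trans ?_
    have h2 : ‖u‖ ^ 2 ≤ R ^ 2 := by gcongr
    have h3 : η * R ^ 2 ≤ ε / 3 := by
      rw [hη, div_mul_eq_mul_div, div_le_iff₀ (by positivity)]
      nlinarith
    calc η * (h n * ‖u‖) ^ 2 = η * ‖u‖ ^ 2 * h n ^ 2 := by ring
      _ ≤ η * R ^ 2 * h n ^ 2 := by gcongr
      _ ≤ _ := by gcongr

/-- The summands of the linear statistics that control the noise: the tilted noise and the
coordinates of the tilted score. -/
noncomputable def tiltedSummand (κ : Kernel (E w) ℝ) (K : E w → ℝ) (h : ℝ) (x : E w) (y : ℝ)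
    (l : E w) : Option (Fin w) → E w × ℝ → ℝ
  | none => fun z => K (h⁻¹ • (z.1 - x)) / (1 + ⟪l, score K h x z.1⟫) *
      (Set.indicator (Set.Iic y) (fun _ => (1 : ℝ)) z.2 - condCDF κ y z.1)
  | some j => fun z => score K h x z.1 j / (1 + ⟪l, score K h x z.1⟫)

theorem measurable_condCDF (κ : Kernel (E w) ℝ) (y : ℝ) : Measurable (condCDF κ y) :=
  (Kernel.measurable_coe κ measurableSet_Iic).ennreal_toReal

theorem KernelAssumption.measurable_rescaled (hK : KernelAssumption K μ₂ ν₀ ν₂) (h : ℝ) (x : E w) :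
    Measurable fun z : E w => K (h⁻¹ • (z - x)) := by
  have := hK.continuous
  exact Continuous.measurable (by fun_prop)

theorem KernelAssumption.measurable_tilt (hK : KernelAssumption K μ₂ ν₀ ν₂) (h : ℝ) (x l : E w) :
    Measurable fun z : E w => 1 + ⟪l, score K h x z⟫ :=
  measurable_const.add (measurable_inner_left (hK.measurable_score _ _) l)

theorem KernelAssumption.measurable_tiltedSummand (hK : KernelAssumption K μ₂ ν₀ ν₂)
    (κ : Kernel (E w) ℝ) (h : ℝ) (x : E w) (y : ℝ) (l : E w) (o : Option (Fin w)) :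
    Measurable (tiltedSummand κ K h x y l o) := by
  cases o with
  | none =>
    exact (((hK.measurable_rescaled h x).comp measurable_fst).div
      ((hK.measurable_tilt h x l).comp measurable_fst)).mul
      (((measurable_const.indicator measurableSet_Iic).comp measurable_snd).sub
        ((measurable_condCDF κ y).comp measurable_fst))
  | some j =>
    have h1 : Measurable fun z : E w => score K h x z j :=
      (EuclideanSpace.proj (𝕜 := ℝ) j).continuous.measurable.comp (hK.measurable_score h x)
    exact (h1.comp measurable_fst).div ((hK.measurable_tilt h x l).comp measurable_fst)

theorem abs_div_tilt_le {h C r : ℝ} (hC : ∀ (h : ℝ) (x z : E w), ‖score K h x z‖ ≤ C)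
    (hrC : r * C ≤ 1 / 8) {l : E w} (hl : ‖l‖ ≤ r) (z : E w) (t : ℝ) :
    |t / (1 + ⟪l, score K h x z⟫)| ≤ 2 * |t| := by
  have h1 := abs_le.mp (abs_inner_le_of_mul_le (hC h x z) hl hrC)
  rw [abs_div, abs_of_pos (by linarith : 0 < 1 + ⟪l, score K h x z⟫), div_le_iff₀ (by linarith)]
  nlinarith [abs_nonneg t]

theorem KernelAssumption.abs_tiltedSummand_le (hK : KernelAssumption K μ₂ ν₀ ν₂)
    (κ : Kernel (E w) ℝ) [IsMarkovKernel κ] (h : ℝ) (x : E w) (y : ℝ) {C CK r : ℝ}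
    (hC : ∀ (h : ℝ) (x z : E w), ‖score K h x z‖ ≤ C) (hCK : ∀ u, K u ≤ CK)
    (hrC : r * C ≤ 1 / 8) {l : E w} (hl : ‖l‖ ≤ r) (o : Option (Fin w)) (z : E w × ℝ) :
    |tiltedSummand κ K h x y l o z| ≤ 2 * (CK + C) := by
  have hC0 : 0 ≤ C := (norm_nonneg _).trans (hC 1 x x)
  have hCK0 : 0 ≤ CK := (hK.nonneg 0).trans (hCK 0)
  cases o with
  | none =>
    have h1 := abs_div_tilt_le (h := h) (x := x) hC hrC hl z.1 (K (h⁻¹ • (z.1 - x)))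
    rw [abs_of_nonneg (hK.nonneg (h⁻¹ • (z.1 - x)))] at h1
    have h2 := abs_indicator_sub_condCDF_le κ y z.2 z.1
    have h3 := hCK (h⁻¹ • (z.1 - x))
    rw [tiltedSummand, abs_mul]
    calc _ ≤ (2 * CK) * 1 := mul_le_mul (h1.trans (by linarith)) h2 (abs_nonneg _) (by linarith)
      _ ≤ _ := by linarith
  | some j =>
    have h1 := abs_div_tilt_le (h := h) (x := x) hC hrC hl z.1 (score K h x z.1 j)
    have h2 := (abs_coord_le (score K h x z.1) j).trans (hC _ _ _)
    rw [tiltedSummand]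
    linarith

theorem tiltedSummand_eq_zero (κ : Kernel (E w) ℝ) {h R : ℝ} (hh : 0 < h)
    (hR : ∀ u, K u ≠ 0 → ‖u‖ ≤ R) (x : E w) (y : ℝ) (l : E w) (o : Option (Fin w)) (z : E w × ℝ)
    (hz : R * h < ‖z.1 - x‖) : tiltedSummand κ K h x y l o z = 0 := by
  have h0 : K (h⁻¹ • (z.1 - x)) = 0 := by
    by_contra hne
    have h1 := hR _ hne
    rw [norm_smul, norm_inv, Real.norm_of_nonneg hh.le, ← div_eq_inv_mul, div_le_iff₀ hh] at h1
    linarith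
  cases o with
  | none => simp only [tiltedSummand, h0, zero_div, zero_mul]
  | some j => simp only [tiltedSummand, score, h0, zero_smul, PiLp.zero_apply, zero_div]

/-- All these means vanish exactly: the noise by conditioning on the predictor, the score
coordinates by the population first order condition tested against the basis vectors. Without the
tilt, the score would have a mean that need not be negligible at the rate `(n h^w)^{-1/2}`. -/
theorem KernelAssumption.integral_tiltedSummand [IsProbabilityMeasure μ]
    (hK : KernelAssumption K μ₂ ν₀ ν₂) (hX : Measurable (X 0)) (hY : Measurable (Y 0))
    (κ : Kernel (E w) ℝ) [IsMarkovKernel κ] (hκ : HasCondDistrib (Y 0) (X 0) κ μ) (h : ℝ)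
    (y : ℝ) {C CK r : ℝ}
    (hC : ∀ (h : ℝ) (x z : E w), ‖score K h x z‖ ≤ C) (hCK : ∀ u, K u ≤ CK)
    (hrC : r * C ≤ 1 / 8) {l : E w} (hl : ‖l‖ ≤ r)
    (hfoc : ∀ e : E w, ∫ ω, ⟪e, score K h x (X 0 ω)⟫ / (1 + ⟪l, score K h x (X 0 ω)⟫) ∂μ = 0)
    (o : Option (Fin w)) : ∫ ω, tiltedSummand κ K h x y l o (X 0 ω, Y 0 ω) ∂μ = 0 := by
  cases o with
  | none =>
    refine integral_mul_indicator_sub_condCDF hκ hX hY y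
      (ψ := fun z => K (h⁻¹ • (z - x)) / (1 + ⟪l, score K h x z⟫))
      ((hK.measurable_rescaled h x).div (hK.measurable_tilt h x l)) (C := 2 * CK) fun z => ?_
    have h1 := abs_div_tilt_le (h := h) (x := x) hC hrC hl z (K (h⁻¹ • (z - x)))
    rw [abs_of_nonneg (hK.nonneg _)] at h1
    linarith [hCK (h⁻¹ • (z - x))]
  | some j =>
    rw [← hfoc (EuclideanSpace.single j 1)]
    simp only [tiltedSummand, EuclideanSpace.inner_single_left, map_one, one_mul]

/-- The random tilt is traded for the deterministic `L n`. After that only sums over single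
observations remain, to which the variance bound applies. -/
theorem isBigOInProb_noise [IsProbabilityMeasure μ] (hw : 1 ≤ w) (hX : ∀ i, Measurable (X i))
    (hY : ∀ i, Measurable (Y i))
    (hγ : 0 < γ) (hh : BandwidthAssumption w δ h)
    (hK : KernelAssumption K μ₂ ν₀ ν₂) (κ : Kernel (E w) ℝ) [IsMarkovKernel κ]
    (hκ : HasCondDistrib (Y 0) (X 0) κ μ) {y : ℝ}
    (hmean : ∀ φ : E w → ℝ, Continuous φ → HasCompactSupport φ →
      Tendsto (fun n => (h n ^ w)⁻¹ * ∫ ω, φ ((h n)⁻¹ • (X 0 ω - x)) ∂μ) atTop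
        (𝓝 (γ * ∫ u, φ u)))
    (hlln : ∀ φ : E w → ℝ, Continuous φ → HasCompactSupport φ → ∀ ε : ℝ, 0 < ε →
      Likely μ fun n ω => |((n : ℝ) * h n ^ w)⁻¹ *
        ∑ i ∈ Finset.range n, φ ((h n)⁻¹ • (X i ω - x)) - γ * ∫ u, φ u| ≤ ε)
    (hO : ∀ (R : ℝ), 0 ≤ R → ∀ (C : ℝ) (f : ℕ → E w × ℝ → ℝ),
      (∀ᶠ n in atTop, Measurable (f n) ∧ (∀ z, |f n z| ≤ C) ∧
        ∀ z, R * h n < ‖z.1 - x‖ → f n z = 0) →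
      IsBigOInProb μ (fun n ω => ((n : ℝ) * h n ^ w)⁻¹ *
        (∑ i ∈ Finset.range n, f n (X i ω, Y i ω) - n * ∫ ω, f n (X 0 ω, Y 0 ω) ∂μ))
      (fun n => ((n : ℝ) * h n ^ w) ^ (-(1 / 2) : ℝ)))
    {p : ∀ n : ℕ, Ω → Fin n → ℝ}
    (hp : ∀ (n : ℕ) (ω : Ω),
      (∃ q, IsAdjustmentWeights K (h n) x (fun i : Fin n => X i ω) q) →
        IsAdjustmentWeights K (h n) x (fun i : Fin n => X i ω) (p n ω)) :
    IsBigOInProb μ (noise κ K h x y X Y p) (fun n => ((n : ℝ) * h n ^ w) ^ (-(1 / 2) : ℝ)) := by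
  obtain ⟨C, hC0, hC⟩ := hK.exists_norm_le
  obtain ⟨R, hR0, hR⟩ := hK.exists_radius
  obtain ⟨CK, hCK⟩ := hK.bounded
  set r := 1 / 8 / (C + 1) with hr
  have hr0 : 0 < r := by positivity
  have hrC : r * C ≤ 1 / 8 := by
    rw [hr, div_mul_eq_mul_div, div_le_iff₀ (by positivity)]
    nlinarith
  obtain ⟨L, hL⟩ := (exists_population_tilt (hX 0) hw hγ hh hK hmean hC hr0 hrC).choice
  have hQ : ∀ o, IsBigOInProb μ (fun n ω => ((n : ℝ) * h n ^ w)⁻¹ *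
      (∑ i ∈ Finset.range n, tiltedSummand κ K (h n) x y (L n) o (X i ω, Y i ω) -
        n * ∫ ω, tiltedSummand κ K (h n) x y (L n) o (X 0 ω, Y 0 ω) ∂μ))
      (fun n => ((n : ℝ) * h n ^ w) ^ (-(1 / 2) : ℝ)) := by
    intro o
    refine hO R hR0 (2 * (CK + C)) (fun n => tiltedSummand κ K (h n) x y (L n) o) ?_
    filter_upwards [hL] with n hn
    exact ⟨hK.measurable_tiltedSummand κ _ x y _ o,
      hK.abs_tiltedSummand_le κ _ x y hC hCK hrC hn.1.le o,
      tiltedSummand_eq_zero κ (hh.pos n) hR x y _ o⟩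
  have hint : ∀ᶠ n in atTop, ∀ o,
      ∫ ω, tiltedSummand κ K (h n) x y (L n) o (X 0 ω, Y 0 ω) ∂μ = 0 := by
    filter_upwards [hL] with n hn o
    exact hK.integral_tiltedSummand (hX 0) (hY 0) κ hκ _ y hC hCK hrC hn.1.le hn.2 o
  set v := γ * ν₂ / 2 with hv
  have hv0 : 0 < v := by have := hK.sq_second_moment_pos; positivity
  refine IsBigOInProb.of_likely_le (fun n => Real.rpow_nonneg
    (mul_nonneg (Nat.cast_nonneg n) (pow_nonneg (hh.pos n).le w)) _) hQ
    (c := 4 / γ + 8 * C / v) (by positivity) ?_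
  refine ((likely_density_le hγ hK hlln).and
    (likely_adjustmentWeights hw hγ hh hK hlln hp hC hr0 hrC)).mono ?_
  filter_upwards [eventually_gt_atTop 0, hint, hL] with n hn hint hLn ω hω
  obtain ⟨hden, hquad, l, hl, hfoc, hpw⟩ := hω
  have h0 := hh.pos n
  have hN : 0 < (n : ℝ) * h n ^ w := mul_pos (by exact_mod_cast hn) (pow_pos h0 w)
  have hb := abs_noise_le (xs := fun i : Fin n => X i ω) hK.nonneg hγ hv0 hN (hC _ _) hl.le
    hLn.1.le hrC (e := fun i : Fin n => Set.indicator (Set.Iic y) (fun _ => (1 : ℝ)) (Y i ω) -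
      condCDF κ y (X i ω)) (fun i => abs_indicator_sub_condCDF_le κ y _ _) hfoc hquad hden
  -- The sum over `Option (Fin w)` splits into the tilted noise and the `w` score coordinates, which
  -- is the right side of `abs_noise_le`.
  simp only [hint, mul_zero, sub_zero, Fintype.sum_option, Finset.sum_range]
  have hfw := finalWeight_eq K h0 x (fun i : Fin n => X i ω) hn hpw
  simp only [noise, hfw]
  exact hb

end Estimator

end RNW

/-- Consistency of the reweighted Nadaraya-Watson estimator. The sample of size `n` is
`(X 0, Y 0), …, (X (n-1), Y (n-1))`; `κ` is any version of the conditional distribution of the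
response given the predictor, and `p n ω` is any choice of adjustment weights, arbitrary at those
outcomes where the maximization problem has no solution. -/
theorem mainTheorem3 {Ω : Type*} [MeasurableSpace Ω] (μ : Measure Ω) [IsProbabilityMeasure μ]
    (w : ℕ) (hw : 1 ≤ w) (X : ℕ → Ω → RNW.E w) (Y : ℕ → Ω → ℝ)
    (hX : ∀ i, Measurable (X i)) (hY : ∀ i, Measurable (Y i))
    (δ : ℝ) (hδ : 0 < δ) (hmix : RNW.MixingAssumption μ (fun i ω => (X i ω, Y i ω)) δ)
    (κ : Kernel (RNW.E w) ℝ) [IsMarkovKernel κ] (hκ : HasCondDistrib (Y 0) (X 0) κ μ)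
    (g : RNW.E w → ℝ) (hg : RNW.HasDensity μ (X 0) g)
    (G : ℕ → RNW.E w × RNW.E w → ℝ)
    (hG : ∀ i, 1 ≤ i → RNW.HasDensity μ (fun ω => (X 0 ω, X i ω)) (G i))
    (x : RNW.E w) (y : ℝ) (hsmooth : RNW.SmoothnessAssumption κ g G x y)
    (K : RNW.E w → ℝ) (μ₂ ν₀ ν₂ : ℝ) (hK : RNW.KernelAssumption K μ₂ ν₀ ν₂)
    (h : ℕ → ℝ) (hh : RNW.BandwidthAssumption w δ h)
    (p : ∀ n : ℕ, Ω → Fin n → ℝ)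
    (hp : ∀ (n : ℕ) (ω : Ω),
      (∃ q, RNW.IsAdjustmentWeights K (h n) x (fun i : Fin n => X i ω) q) →
        RNW.IsAdjustmentWeights K (h n) x (fun i : Fin n => X i ω) (p n ω)) :
    ∃ R₁ R₂ : ℕ → Ω → ℝ,
      (∀ (n : ℕ) (ω : Ω),
        RNW.estimator K (h n) x (fun i : Fin n => X i ω) (fun i : Fin n => Y i ω) (p n ω) y
            - RNW.condCDF κ y x
          = 1 / 2 * h n ^ 2 * (RNW.hessian (fun z => RNW.condCDF κ y z) x).trace * μ₂
            + R₁ n ω + R₂ n ω) ∧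
      RNW.IsLittleOInProb μ R₁ (fun n => h n ^ 2) ∧
      RNW.IsBigOInProb μ R₂ (fun n => ((n : ℝ) * h n ^ w) ^ (-(1 / 2) : ℝ)) := by
  have hO := fun (R : ℝ) (hR : 0 ≤ R) (C : ℝ) (f : ℕ → RNW.E w × ℝ → ℝ) hf =>
    RNW.isBigOInProb_sum hX hY hδ hmix hg hG hsmooth.density_cont hsmooth.joint_bound hh
      (R := R) hR (C := C) (f := f) hf
  have hlln : ∀ φ : RNW.E w → ℝ, Continuous φ → HasCompactSupport φ → ∀ ε : ℝ, 0 < ε →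
      RNW.Likely μ fun n ω => |((n : ℝ) * h n ^ w)⁻¹ *
        ∑ i ∈ Finset.range n, φ ((h n)⁻¹ • (X i ω - x)) - g x * ∫ u, φ u| ≤ ε := by
    intro φ hφ hφs ε hε
    have := RNW.tendsto_kernel_average hX hY hδ hmix hg hG hsmooth.density_cont
      hsmooth.joint_bound hh hφ hφs hε
    simpa only [RNW.Likely, not_le] using this
  have hmean := fun (φ : RNW.E w → ℝ) (hφ : Continuous φ) (hφs : HasCompactSupport φ) =>
    RNW.tendsto_mean (hX 0) hg hsmooth.density_cont hh hφ hφs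
  -- `R₂` is the noise and `R₁` whatever is left, so the decomposition is an identity and only the
  -- two orders need proof.
  refine ⟨fun n ω => RNW.estimator K (h n) x (fun i : Fin n => X i ω) (fun i : Fin n => Y i ω)
      (p n ω) y - RNW.condCDF κ y x -
      1 / 2 * h n ^ 2 * (RNW.hessian (fun z => RNW.condCDF κ y z) x).trace * μ₂ -
      RNW.noise κ K h x y X Y p n ω, RNW.noise κ K h x y X Y p, fun n ω => by ring, ?_, ?_⟩
  · intro ε hε
    have := RNW.likely_bias_le (Y := Y) hw hsmooth.density_pos hh hK κ hsmooth.cdf_smooth hlln hp hε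
    simpa only [RNW.Likely, not_le] using this
  · exact RNW.isBigOInProb_noise hw hX hY hsmooth.density_pos hh hK κ hκ hmean hlln hO hp
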